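/- Let $\mathcal X,\mathcal Y$ be finite sets and let $W$ be a stochastic matrix assigning to each $x\in\mathcal X$ a probability mass function $W(\cdot|x)$ on $\mathcal Y$. For $\alpha\in(0,1)$ and a probability mass function $p$ on $\mathcal X$ let \[ I_\alpha(p;W)=\tfrac{\alpha}{\alpha-1}\ln\sum_{y}\Big[\sum_{x}p(x)W(y|x)^{\alpha}\Big]^{1/\alpha},\qquad I_1(p;W)=\sum_{x}p(x)\sum_{y}W(y|x)\ln\tfrac{W(y|x)}{\sum_{z}p(z)W(y|z)}, \] let $C_\alpha=\sup_p I_\alpha(p;W)$ for $\alpha\in(0,1]$ be the order-$\alpha$ Rényi capacity, let $C_0=\lim_{\alpha\downarrow0}C_\alpha$, and let $E_{sp}(R,W)=\sup_{\alpha\in(0,1)}\tfrac{1-\alpha}{\alpha}(C_\alpha-R)$ be the sphere packing exponent. The length $n$ discrete stationary product channel with feedback with component channel $W$ has as inputs the sequences $\vec x=(\vec x_1,\dots,\vec x_n)$ of functions $\vec x_t:\mathcal Y^{t-1}\to\mathcal X$ (so $\vec x_1\in\mathcal X$), and the output $y_1^n\in\mathcal Y^n$ has probability $\prod_{t=1}^n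 W(y_t|\vec x_t(y_1,\dots,y_{t-1}))$ given $\vec x$. A rate $R$ channel code on it consists of an encoding function from $\{1,\dots,\lceil e^{nR}\rceil\}$ to the set of these inputs and a decoding function from $\mathcal Y^n$ to $\{1,\dots,\lceil e^{nR}\rceil\}$. Its average error probability $P_{e,av}$ is the average over all messages $m$ of the probability, given that the input is the one assigned to $m$, that the decoded message is not $m$. Suppose that $C_0\neq C_1$, that $C_0<R_0<R_1<C_1$, that $\alpha_0\in(0,1)$ satisfies $C_{\alpha_0}=R_0$, that $\alpha_1\in(\alpha_0,1)$ satisfies $\tfrac{1-\alpha_1}{\alpha_1}C_{\alpha_1}=E_{sp}(R_1,W)$, that $0<\epsilon\le\tfrac12\min(\alpha_0,1-\alpha_1)$, and that $n,\kappa$ are positive integers with $\kappa\le n$. For a real number $R$ let \[ \delta_1=\frac{\ln4}{n}+8\,\frac{2+C_{1/2}}{(1-\alpha_1)\sqrt{\kappa}}+\frac{\kappa}{n}\ln\Big(n+\frac1\epsilon\Big),\qquad \delta_2=\frac{\ln4}{n}+8\,\frac{2+C_{1/2}}{\alpha_0\sqrt{\kappa}}+\frac{\kappa\ln n}{n}+\frac{2R\epsilon}{\alpha_0^{2}}.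 \] If $R_1\ge R\ge R_0+\delta_1$, then $E_{sp}(R-\delta_1,W)$ is finite and every rate $R$ channel code on the length $n$ discrete stationary product channel with feedback with component channel $W$ satisfies \[ P_{e,av}\ \ge\ e^{-n\left[E_{sp}(R-\delta_1,W)+\delta_2\right]}. \] -/

import Mathlib

open Filter Topology

noncomputable section

/-- The order-`α` Rényi information for the prior `p` on the channel `W`, for `α ∈ (0, 1]`.
At `α = 1` the terms with `W(y|x) = 0` vanish, as usual. -/
def renyiInformation {X Y : Type*} [Fintype X] [Fintype Y] (α : ℝ)
    (p : stdSimplex ℝ X) (W : X → stdSimplex ℝ Y) : ℝ :=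
  if α = 1 then
    ∑ x, p x * ∑ y, W x y * Real.log (W x y / ∑ z, p z * W z y)
  else
    α / (α - 1) * Real.log (∑ y, (∑ x, p x * (W x y) ^ α) ^ (1 / α))

/-- The order-`α` Rényi capacity `C_α` of the channel `W`, for `α ∈ (0, 1]`. -/
def renyiCapacity {X Y : Type*} [Fintype X] [Fintype Y] (α : ℝ)
    (W : X → stdSimplex ℝ Y) : ℝ :=
  ⨆ p : stdSimplex ℝ X, renyiInformation α p W

/-- The order-`0` Rényi capacity `C_0`: the limit of `C_α` as `α ↓ 0`. -/
def renyiCapacityZero {X Y : Type*} [Fintype X] [Fintype Y]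
    (W : X → stdSimplex ℝ Y) : ℝ :=
  limUnder (𝓝[>] (0 : ℝ)) (fun α : ℝ => renyiCapacity α W)

/-- The sphere packing exponent. It may be infinite, hence it takes values in the extended
real numbers. -/
def spherePackingExponent {X Y : Type*} [Fintype X] [Fintype Y] (R : ℝ)
    (W : X → stdSimplex ℝ Y) : EReal :=
  ⨆ α : Set.Ioo (0 : ℝ) 1,
    (((1 - (α : ℝ)) / (α : ℝ) * (renyiCapacity (α : ℝ) W - R) : ℝ) : EReal)

/-- An input of a length-`n` channel with feedback: at each time `t` a function of the
outputs at the times before `t`. -/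
abbrev FeedbackInput (n : ℕ) (X Y : Type*) : Type _ :=
  (t : Fin n) → (Fin (t : ℕ) → Y) → X

/-- The length-`n` discrete product channel with feedback whose component channel at time `t`
is `W t`: the probability of the output string `y` given the feedback input `x`. -/
def feedbackChannel {n : ℕ} {X Y : Type*} [Fintype Y] (W : Fin n → X → stdSimplex ℝ Y)
    (x : FeedbackInput n X Y) (y : Fin n → Y) : ℝ :=
  ∏ t : Fin n, W t (x t (fun s : Fin (t : ℕ) => y (Fin.castLE t.isLt.le s))) (y t)

/-- The number of messages `⌈exp (n R)⌉` of a rate `R` code of block length `n`. -/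
def messageCount (n : ℕ) (R : ℝ) : ℕ := ⌈Real.exp ((n : ℝ) * R)⌉₊

/-- A rate `R` channel code for length-`n` channels with feedback, with input alphabet `X` and
output alphabet `Y`. -/
structure FeedbackCode (n : ℕ) (R : ℝ) (X Y : Type*) where
  /-- The encoding function. -/
  enc : Fin (messageCount n R) → FeedbackInput n X Y
  /-- The decoding function. -/
  dec : (Fin n → Y) → Fin (messageCount n R)

/-- The conditional error probability of the message `m`. -/
def FeedbackCode.condErrorProb {n : ℕ} {R : ℝ} {X Y : Type*} [Fintype Y]
    (c : FeedbackCode n R X Y) (W : Fin n → X → stdSimplex ℝ Y)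
    (m : Fin (messageCount n R)) : ℝ :=
  1 - ∑ y : Fin n → Y, if c.dec y = m then feedbackChannel W (c.enc m) y else 0

/-- The average error probability over the messages. -/
def FeedbackCode.avgErrorProb {n : ℕ} {R : ℝ} {X Y : Type*} [Fintype Y]
    (c : FeedbackCode n R X Y) (W : Fin n → X → stdSimplex ℝ Y) : ℝ :=
  1 / (messageCount n R : ℝ) * ∑ m, c.condErrorProb W m

end

/-!
The bound compares every input law with one output law that does not depend on the input, through
an auxiliary law: a law `V` that is at most `exp (n R)` times the reference output law and at most
`exp (n E)` times the law given the input, with high `V`-probability. A decoder guesses the message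
correctly with probability at most `1 / M` on average under the reference law, hence fails often
under `V`, hence fails with probability of order `exp (-n E)` under the true law
(`FeedbackCode.le_avgErrorProb`).

With feedback the input letter depends on the outputs, so the order of the tilted law `V` has to be
allowed to do so as well. The string is cut into `κ` blocks, and on each block the order is chosen
anew, knowing the earlier outputs. For a given block and continuation of the input, let `P` be the
law of the block and consider the laws `V ∝ P^α Q^(1-α)`, where `Q` is a product law of Rényi
centers. They satisfy `(1 - α) D(V‖Q) + α D(V‖P) = (1 - α) D_α(P‖Q)`, and the right side is at most
`(1 - α)` times the block length times `C_α` when `Q` is built from the center of order `α`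
(`exists_renyi_center`). At the order `α₀` this forces `D(V‖Q)` below the rate. If it stays below
at all orders of a finite net, the order `α₁` serves. Otherwise the intermediate value theorem
gives a law with `D(V‖Q)` equal to the rate, and the identity bounds `D(V‖P)` by the sphere packing
exponent (`exists_tilt_of_net`). The centers need not depend continuously on the order: between
consecutive points of the net the order moves while `Q` is fixed, and then `Q` moves along a segment
while the order is fixed. The uniform mixture over the net dominates, up to the factor `1 / ε`,
every `Q` that can occur, so it is a reference law for the block (`exists_block_reference`), and
products of these are reference laws for the string (`exists_reference_of_blocks`).

Across blocks the centred log-likelihood ratios are martingale differences. Their standard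
deviation on a block is at most proportional to the block length (`sum_tilt_mul_sq_log_le`), so
that of the sum is of order `√κ * (n / κ) = n / √κ`, and Chebyshev's inequality suffices.
-/

/-! ### Affinities and tilted probability mass functions on a finite set -/

/-- The order-`α` affinity `∑ P^α Q^(1-α)`, that is `exp ((α - 1) D_α(P‖Q))` for the Rényi
divergence `D_α`. -/
noncomputable def affinity {Ω : Type*} [Fintype Ω] (α : ℝ) (P Q : Ω → ℝ) : ℝ :=
  ∑ ω, P ω ^ α * Q ω ^ (1 - α)

/-- The order-`α` tilted probability mass function between `P` and `Q`, the normalization of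
`P^α Q^(1-α)`. -/
noncomputable def tilt {Ω : Type*} [Fintype Ω] (α : ℝ) (P Q : Ω → ℝ) (ω : Ω) : ℝ :=
  P ω ^ α * Q ω ^ (1 - α) / affinity α P Q

/-- The Kullback–Leibler divergence `D(V‖Q) = ∑ V log (V / Q)` on a finite set. It has its usual
value when `V` vanishes wherever `Q` does. -/
noncomputable def relEntropy {Ω : Type*} [Fintype Ω] (V Q : Ω → ℝ) : ℝ :=
  ∑ ω, V ω * Real.log (V ω / Q ω)

section Tilting

variable {Ω : Type*} [Fintype Ω] {P Q Q' : Ω → ℝ} {α η : ℝ}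

lemma affinity_swap (α : ℝ) (P Q : Ω → ℝ) : affinity (1 - α) Q P = affinity α P Q := by
  unfold affinity
  refine Finset.sum_congr rfl fun ω _ => ?_
  rw [mul_comm]; congr 2; ring

lemma tilt_swap (α : ℝ) (P Q : Ω → ℝ) : tilt (1 - α) Q P = tilt α P Q := by
  funext ω
  unfold tilt
  rw [affinity_swap, mul_comm]; congr 3; ring

lemma affinity_le_one (hα : α ∈ Set.Ioo (0 : ℝ) 1) (hP : P ∈ stdSimplex ℝ Ω)
    (hQ : Q ∈ stdSimplex ℝ Ω) : affinity α P Q ≤ 1 := by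
  have h : affinity α P Q ≤ ∑ ω, (α * P ω + (1 - α) * Q ω) :=
    Finset.sum_le_sum fun ω _ => Real.geom_mean_le_arith_mean2_weighted hα.1.le
      (by linarith [hα.2]) (hP.1 ω) (hQ.1 ω) (by ring)
  rw [Finset.sum_add_distrib, ← Finset.mul_sum, ← Finset.mul_sum, hP.2, hQ.2] at h
  linarith

/-- `α ↦ (affinity α P Q)^(1/α)` is nondecreasing: it is the norm of `P / Q` in `L^α(Q)`. -/
lemma affinity_rpow_le (hη : 0 < η) (hηα : η ≤ α) (hα : α < 1) (hP : ∀ ω, 0 ≤ P ω)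
    (hQ : Q ∈ stdSimplex ℝ Ω) : affinity η P Q ^ (α / η) ≤ affinity α P Q := by
  have key : ∀ s : ℝ, s < 1 → affinity s P Q = ∑ ω, Q ω * (P ω / Q ω) ^ s := by
    intro s hs
    refine Finset.sum_congr rfl fun ω _ => ?_
    rcases (hQ.1 ω).eq_or_lt with h | h
    · rw [← h, Real.zero_rpow (by linarith)]; simp
    · rw [Real.div_rpow (hP ω) h.le, Real.rpow_sub h, Real.rpow_one]
      field_simp
  have h := Real.rpow_arith_mean_le_arith_mean_rpow Finset.univ Q (fun ω => (P ω / Q ω) ^ η)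
    (fun ω _ => hQ.1 ω) hQ.2 (fun ω _ => Real.rpow_nonneg (div_nonneg (hP ω) (hQ.1 ω)) _)
    (p := α / η) (by rwa [one_le_div hη])
  rw [key η (by linarith), key α hα]
  refine h.trans (le_of_eq (Finset.sum_congr rfl fun ω _ => ?_))
  rw [← Real.rpow_mul (div_nonneg (hP ω) (hQ.1 ω)), mul_div_cancel₀ _ hη.ne']

lemma exp_neg_le_affinity_of_le {c : ℝ} (hη : 0 < η) (hηα : η ≤ α) (hα : α < 1)
    (hP : ∀ ω, 0 ≤ P ω) (hQ : Q ∈ stdSimplex ℝ Ω) (h : Real.exp (-c) ≤ affinity η P Q) :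
    Real.exp (-(α / η * c)) ≤ affinity α P Q := by
  refine le_trans ?_ (affinity_rpow_le hη hηα hα hP hQ)
  have h0 : 0 ≤ α / η := div_nonneg (hη.le.trans hηα) hη.le
  refine le_trans (le_of_eq ?_) (Real.rpow_le_rpow (Real.exp_pos _).le h h0)
  rw [← Real.exp_mul]; congr 1; ring

/-- The affinity is concave in its second argument. -/
lemma min_le_affinity_mix (hα : α ∈ Set.Ioo (0 : ℝ) 1) (hP : ∀ ω, 0 ≤ P ω)
    (hQ : ∀ ω, 0 ≤ Q ω) (hQ' : ∀ ω, 0 ≤ Q' ω) {s : ℝ} (hs : s ∈ Set.Icc (0 : ℝ) 1) :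
    min (affinity α P Q) (affinity α P Q') ≤
      affinity α P (fun ω => (1 - s) * Q ω + s * Q' ω) := by
  have hc := (Real.concaveOn_rpow (p := 1 - α) (by linarith [hα.2]) (by linarith [hα.1])).2
  have h : (1 - s) * affinity α P Q + s * affinity α P Q' ≤
      affinity α P (fun ω => (1 - s) * Q ω + s * Q' ω) := by
    unfold affinity
    rw [Finset.mul_sum, Finset.mul_sum, ← Finset.sum_add_distrib]
    refine Finset.sum_le_sum fun ω _ => ?_
    have h1 := hc (Set.mem_Ici.2 (hQ ω)) (Set.mem_Ici.2 (hQ' ω)) (sub_nonneg.2 hs.2) hs.1 (by ring)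
    simp only [smul_eq_mul] at h1
    calc _ = P ω ^ α * ((1 - s) * Q ω ^ (1 - α) + s * Q' ω ^ (1 - α)) := by ring
      _ ≤ _ := mul_le_mul_of_nonneg_left h1 (Real.rpow_nonneg (hP ω) _)
  refine le_trans ?_ h
  have h1 := min_le_left (affinity α P Q) (affinity α P Q')
  have h2 := min_le_right (affinity α P Q) (affinity α P Q')
  nlinarith [hs.1, hs.2]

lemma tilt_mem_stdSimplex (hP : ∀ ω, 0 ≤ P ω) (hQ : ∀ ω, 0 ≤ Q ω) (hZ : 0 < affinity α P Q) :
    tilt α P Q ∈ stdSimplex ℝ Ω := by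
  refine ⟨fun ω => div_nonneg (mul_nonneg (Real.rpow_nonneg (hP ω) _)
    (Real.rpow_nonneg (hQ ω) _)) hZ.le, ?_⟩
  unfold tilt
  rw [← Finset.sum_div]
  exact div_self hZ.ne'

lemma pos_of_tilt_ne_zero (hα : α ∈ Set.Ioo (0 : ℝ) 1) (hP : ∀ ω, 0 ≤ P ω)
    (hQ : ∀ ω, 0 ≤ Q ω) {ω : Ω} (h : tilt α P Q ω ≠ 0) : 0 < P ω ∧ 0 < Q ω := by
  constructor
  · refine (hP ω).lt_of_ne fun h0 => h ?_
    unfold tilt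
    rw [← h0, Real.zero_rpow hα.1.ne']; simp
  · refine (hQ ω).lt_of_ne fun h0 => h ?_
    unfold tilt
    rw [← h0, Real.zero_rpow (by linarith [hα.2])]; simp

lemma log_tilt (hZ : 0 < affinity α P Q) {ω : Ω} (hp : 0 < P ω) (hq : 0 < Q ω) :
    Real.log (tilt α P Q ω) =
      α * Real.log (P ω) + (1 - α) * Real.log (Q ω) - Real.log (affinity α P Q) := by
  unfold tilt
  have h1 := Real.rpow_pos_of_pos hp α
  have h2 := Real.rpow_pos_of_pos hq (1 - α)
  rw [Real.log_div (by positivity) hZ.ne', Real.log_mul h1.ne' h2.ne', Real.log_rpow hp,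
    Real.log_rpow hq]

lemma tilt_mul_log_div (hα : α ∈ Set.Ioo (0 : ℝ) 1) (hP : ∀ ω, 0 ≤ P ω) (hQ : ∀ ω, 0 ≤ Q ω)
    (hZ : 0 < affinity α P Q) (ω : Ω) :
    tilt α P Q ω * Real.log (tilt α P Q ω / Q ω) =
      tilt α P Q ω * (α * (Real.log (P ω) - Real.log (Q ω)) - Real.log (affinity α P Q)) := by
  by_cases h : tilt α P Q ω = 0
  · rw [h]; simp
  · obtain ⟨hp, hq⟩ := pos_of_tilt_ne_zero hα hP hQ h
    rw [Real.log_div h hq.ne', log_tilt hZ hp hq]; ring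

/-- The two divergences of the tilted pmf sum, with weights, to `-log` of the affinity. -/
lemma relEntropy_tilt_add (hα : α ∈ Set.Ioo (0 : ℝ) 1) (hP : ∀ ω, 0 ≤ P ω) (hQ : ∀ ω, 0 ≤ Q ω)
    (hZ : 0 < affinity α P Q) :
    (1 - α) * relEntropy (tilt α P Q) Q + α * relEntropy (tilt α P Q) P =
      -Real.log (affinity α P Q) := by
  have hV := (tilt_mem_stdSimplex hP hQ hZ).2
  unfold relEntropy
  have hlog : -Real.log (affinity α P Q) =
      ∑ ω, tilt α P Q ω * -Real.log (affinity α P Q) := by rw [← Finset.sum_mul, hV, one_mul]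
  rw [Finset.mul_sum, Finset.mul_sum, ← Finset.sum_add_distrib, hlog]
  refine Finset.sum_congr rfl fun ω _ => ?_
  by_cases h : tilt α P Q ω = 0
  · rw [h]; simp
  · obtain ⟨hp, hq⟩ := pos_of_tilt_ne_zero hα hP hQ h
    rw [Real.log_div h hq.ne', Real.log_div h hp.ne', log_tilt hZ hp hq]; ring

/-- Gibbs' inequality. The support condition excludes the value `0` of `log (V ω / 0)`. -/
lemma relEntropy_nonneg {V : Ω → ℝ} (hV : V ∈ stdSimplex ℝ Ω) (hQ : Q ∈ stdSimplex ℝ Ω)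
    (hVQ : ∀ ω, V ω ≠ 0 → 0 < Q ω) : 0 ≤ relEntropy V Q := by
  have h : ∑ ω, (V ω - Q ω) ≤ relEntropy V Q := by
    refine Finset.sum_le_sum fun ω _ => ?_
    by_cases h : V ω = 0
    · rw [h]; simpa using hQ.1 ω
    · have hq := hVQ ω h
      have hv : 0 < V ω := (hV.1 ω).lt_of_ne' h
      have := Real.one_sub_inv_le_log_of_pos (div_pos hv hq)
      calc V ω - Q ω = V ω * (1 - (V ω / Q ω)⁻¹) := by field_simp
        _ ≤ _ := mul_le_mul_of_nonneg_left this hv.le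
  rw [Finset.sum_sub_distrib, hV.2, hQ.2] at h
  linarith

lemma relEntropy_tilt_left_le (hα : α ∈ Set.Ioo (0 : ℝ) 1) (hP : P ∈ stdSimplex ℝ Ω)
    (hQ : Q ∈ stdSimplex ℝ Ω) {r : ℝ} (h : Real.exp (-((1 - α) * r)) ≤ affinity α P Q) :
    relEntropy (tilt α P Q) Q ≤ r := by
  have hZ := (Real.exp_pos _).trans_le h
  have h1 := relEntropy_tilt_add hα hP.1 hQ.1 hZ
  have h2 := relEntropy_nonneg (tilt_mem_stdSimplex hP.1 hQ.1 hZ) hP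
    fun ω hω => (pos_of_tilt_ne_zero hα hP.1 hQ.1 hω).1
  have h3 := (Real.le_log_iff_exp_le hZ).2 h
  have h4 : 0 < 1 - α := by linarith [hα.2]
  have h5 := mul_nonneg hα.1.le h2
  by_contra! hc
  nlinarith

lemma relEntropy_tilt_right_le (hα : α ∈ Set.Ioo (0 : ℝ) 1) (hP : P ∈ stdSimplex ℝ Ω)
    (hQ : Q ∈ stdSimplex ℝ Ω) {e : ℝ} (h : Real.exp (-(α * e)) ≤ affinity α P Q) :
    relEntropy (tilt α P Q) P ≤ e := by
  rw [← tilt_swap]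
  refine relEntropy_tilt_left_le ⟨by linarith [hα.2], by linarith [hα.1]⟩ hQ hP ?_
  rw [affinity_swap]; simpa using h

/-- The square of the logarithm is bounded through `log u = 4 log (u^(1/4)) ≤ 4 (u^(1/4) - 1)`. -/
lemma log_sq_le {u : ℝ} (hu : 1 ≤ u) : Real.log u ^ 2 ≤ u := by
  set t := u ^ (1 / 4 : ℝ) with ht
  have hu0 : 0 < u := by linarith
  have ht0 : 0 < t := Real.rpow_pos_of_pos hu0 _
  have h4 : t ^ 4 = u := by
    rw [ht, ← Real.rpow_natCast, ← Real.rpow_mul hu0.le]; norm_num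
  have hlog : Real.log u = 4 * Real.log t := by
    rw [← h4, Real.log_pow]; norm_num
  have h1 := Real.log_le_sub_one_of_pos ht0
  have h2 := Real.log_nonneg hu
  have h3 : Real.log u ≤ t ^ 2 := by nlinarith [sq_nonneg (t - 2)]
  calc Real.log u ^ 2 ≤ (t ^ 2) ^ 2 := pow_le_pow_left₀ h2 h3 2
    _ = u := by rw [← h4]; ring

/-- Where `log (v / q)` is negative, its weighted first two absolute moments are at most `q`. -/
lemma mul_sq_log_div_le {v q : ℝ} (hv : 0 < v) (hq : 0 < q) (h : Real.log (v / q) < 0) :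
    v * -Real.log (v / q) ≤ q ∧ v * Real.log (v / q) ^ 2 ≤ q := by
  have hvq : 0 < v / q := div_pos hv hq
  have h1 : v / q < 1 := by
    by_contra! hc
    exact absurd (Real.log_nonneg hc) (by linarith)
  have hinv : -Real.log (v / q) = Real.log (q / v) := by
    rw [← Real.log_inv, inv_div]
  have h2 : 1 ≤ q / v := by
    rw [one_le_div hv]; rw [div_lt_one hq] at h1; exact h1.le
  have h3 := log_sq_le h2
  have h4 := Real.log_le_sub_one_of_pos (div_pos hq hv)
  have h5 : v * (q / v) = q := by field_simp
  constructor
  · rw [hinv]; nlinarith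
  · rw [← neg_sq, hinv]; nlinarith

/-- The second moment of `log (V / Q)` under the tilted pmf `V`: the two log-likelihood ratios
`a = log (V / Q)` and `b = log (V / P)` satisfy `(1 - α) a + α b = A`, and each of them has a
negative part with second moment at most one. -/
lemma sum_tilt_mul_sq_log_le (hα : α ∈ Set.Ioo (0 : ℝ) 1) (hP : P ∈ stdSimplex ℝ Ω)
    (hQ : Q ∈ stdSimplex ℝ Ω) (hZ : 0 < affinity α P Q) :
    ∑ ω, tilt α P Q ω * Real.log (tilt α P Q ω / Q ω) ^ 2 ≤
      ((1 - Real.log (affinity α P Q)) / (1 - α)) ^ 2 := by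
  set A := -Real.log (affinity α P Q) with hA
  have hα0 := hα.1
  have hα1 : 0 < 1 - α := by linarith [hα.2]
  have hA0 : 0 ≤ A := by
    have := Real.log_nonpos hZ.le (affinity_le_one hα hP hQ)
    linarith
  have hV := tilt_mem_stdSimplex (α := α) hP.1 hQ.1 hZ
  have key : ∀ ω, (1 - α) ^ 2 * (tilt α P Q ω * Real.log (tilt α P Q ω / Q ω) ^ 2) ≤
      A ^ 2 * tilt α P Q ω + (2 * A * α + α ^ 2) * P ω + (1 - α) ^ 2 * Q ω := by
    intro ω
    by_cases h : tilt α P Q ω = 0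
    · rw [h]
      have := hP.1 ω
      have := hQ.1 ω
      simp only [zero_mul, mul_zero, zero_add]
      positivity
    obtain ⟨hp, hq⟩ := pos_of_tilt_ne_zero hα hP.1 hQ.1 h
    have hv : 0 < tilt α P Q ω := (hV.1 ω).lt_of_ne' h
    have hab : (1 - α) * Real.log (tilt α P Q ω / Q ω) + α * Real.log (tilt α P Q ω / P ω) = A := by
      rw [Real.log_div h hq.ne', Real.log_div h hp.ne', log_tilt hZ hp hq]; ring
    set v := tilt α P Q ω
    set a := Real.log (v / Q ω) with ha
    set b := Real.log (v / P ω) with hb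
    have hp' : 0 ≤ (2 * A * α + α ^ 2) * P ω := by positivity
    have hq' : 0 ≤ (1 - α) ^ 2 * Q ω := by positivity
    have hv' : 0 ≤ A ^ 2 * v := by positivity
    rcases lt_or_ge a 0 with ha0 | ha0
    · have h1 := mul_le_mul_of_nonneg_left (mul_sq_log_div_le hv hq ha0).2 (sq_nonneg (1 - α))
      linarith
    · have haA : (1 - α) * a = A - α * b := by linarith
      have heq : (1 - α) ^ 2 * (v * a ^ 2) = v * (A - α * b) ^ 2 := by rw [← haA]; ring
      rw [heq]
      have hnn : 0 ≤ A - α * b := haA ▸ mul_nonneg hα1.le ha0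
      rcases lt_or_ge b 0 with hb0 | hb0
      · obtain ⟨h1, h2⟩ := mul_sq_log_div_le hv hp hb0
        have h3 := mul_le_mul_of_nonneg_left h1 (by positivity : 0 ≤ 2 * A * α)
        have h4 := mul_le_mul_of_nonneg_left h2 (by positivity : 0 ≤ α ^ 2)
        have : v * (A - α * b) ^ 2 =
            A ^ 2 * v + 2 * A * α * (v * -b) + α ^ 2 * (v * b ^ 2) := by ring
        rw [this]
        linarith
      · have h1 : (A - α * b) ^ 2 ≤ A ^ 2 :=
          pow_le_pow_left₀ hnn (by nlinarith [mul_nonneg hα0.le hb0]) 2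
        have h2 := mul_le_mul_of_nonneg_left h1 hv.le
        linarith
  have hsum := Finset.sum_le_sum fun ω (_ : ω ∈ Finset.univ) => key ω
  rw [← Finset.mul_sum, Finset.sum_add_distrib, Finset.sum_add_distrib, ← Finset.mul_sum,
    ← Finset.mul_sum, ← Finset.mul_sum, hV.2, hP.2, hQ.2] at hsum
  rw [div_pow, le_div_iff₀ (by positivity), mul_comm]
  have h1A : 1 - Real.log (affinity α P Q) = 1 + A := by rw [hA]; ring
  rw [h1A]
  refine hsum.trans ?_
  nlinarith [mul_nonneg hA0 hα1.le, mul_nonneg hα0.le hα1.le]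

/-! ### Continuity of the divergence of the tilted law -/

/-- The divergence in a form whose terms are continuous also where `Q` vanishes, since
`x ^ β * log x` tends to zero there. -/
lemma relEntropy_tilt_eq (hα : α ∈ Set.Ioo (0 : ℝ) 1) (hP : ∀ ω, 0 ≤ P ω) (hQ : ∀ ω, 0 ≤ Q ω)
    (hZ : 0 < affinity α P Q) :
    relEntropy (tilt α P Q) Q =
      α * (∑ ω, P ω ^ α * (Real.log (P ω) * Q ω ^ (1 - α) - Q ω ^ (1 - α) * Real.log (Q ω))) /
        affinity α P Q - Real.log (affinity α P Q) := by
  have hV := (tilt_mem_stdSimplex hP hQ hZ).2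
  have h1 : relEntropy (tilt α P Q) Q = ∑ ω, tilt α P Q ω * (α * (Real.log (P ω) - Real.log (Q ω)))
      - (∑ ω, tilt α P Q ω) * Real.log (affinity α P Q) := by
    unfold relEntropy
    rw [Finset.sum_mul, ← Finset.sum_sub_distrib]
    refine Finset.sum_congr rfl fun ω _ => ?_
    rw [tilt_mul_log_div hα hP hQ hZ]; ring
  rw [h1, hV, one_mul, Finset.mul_sum, Finset.sum_div]
  congr 1
  refine Finset.sum_congr rfl fun ω _ => ?_
  unfold tilt
  ring

lemma continuousOn_affinity_order (P Q : Ω → ℝ) :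
    ContinuousOn (fun α => affinity α P Q) (Set.Ioo 0 1) := by
  unfold affinity
  refine continuousOn_finsetSum _ fun ω _ => ContinuousOn.mul ?_ ?_
  · exact continuousOn_const.rpow continuousOn_id fun x hx => Or.inr hx.1
  · exact continuousOn_const.rpow (by fun_prop) fun x hx => Or.inr (by linarith [hx.2])

lemma continuousOn_relEntropy_tilt_order {s : Set ℝ} (hs : s ⊆ Set.Ioo 0 1) (hP : ∀ ω, 0 ≤ P ω)
    (hQ : ∀ ω, 0 ≤ Q ω) (hZ : ∀ α ∈ s, 0 < affinity α P Q) :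
    ContinuousOn (fun α => relEntropy (tilt α P Q) Q) s := by
  have hc := (continuousOn_affinity_order P Q).mono hs
  have hp : ∀ ω, ContinuousOn (fun α : ℝ => P ω ^ α) s := fun ω =>
    continuousOn_const.rpow continuousOn_id fun x hx => Or.inr (hs hx).1
  have hq : ∀ ω, ContinuousOn (fun α : ℝ => Q ω ^ (1 - α)) s := fun ω =>
    continuousOn_const.rpow (by fun_prop) fun x hx => Or.inr (by linarith [(hs hx).2])
  refine ContinuousOn.congr ?_ fun α hα => relEntropy_tilt_eq (hs hα) hP hQ (hZ α hα)
  refine ContinuousOn.sub (ContinuousOn.div (continuousOn_id.mul ?_) hc fun α hα => (hZ α hα).ne')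
    (hc.log fun α hα => (hZ α hα).ne')
  exact continuousOn_finsetSum _ fun ω _ => (hp ω).mul
    ((continuousOn_const.mul (hq ω)).sub ((hq ω).mul continuousOn_const))

lemma continuousOn_rpow_mul_log {β : ℝ} (hβ : 0 < β) :
    ContinuousOn (fun x : ℝ => x ^ β * Real.log x) (Set.Ici 0) := by
  have h : Continuous fun x : ℝ => x ^ β * Real.log (x ^ β) / β :=
    (Real.continuous_mul_log.comp (Real.continuous_rpow_const hβ.le)).div_const β
  refine h.continuousOn.congr fun x hx => ?_
  rcases (Set.mem_Ici.1 hx).eq_or_lt with h0 | h0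
  · simp [← h0, hβ.ne']
  · simp only [Real.log_rpow h0]; field_simp

lemma continuousOn_relEntropy_tilt_mix (hα : α ∈ Set.Ioo (0 : ℝ) 1) (hP : ∀ ω, 0 ≤ P ω)
    (hQ : ∀ ω, 0 ≤ Q ω) (hQ' : ∀ ω, 0 ≤ Q' ω)
    (hZ : ∀ s ∈ Set.Icc (0 : ℝ) 1, 0 < affinity α P (fun ω => (1 - s) * Q ω + s * Q' ω)) :
    ContinuousOn (fun s : ℝ => relEntropy (tilt α P fun ω => (1 - s) * Q ω + s * Q' ω)
      fun ω => (1 - s) * Q ω + s * Q' ω) (Set.Icc 0 1) := by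
  have hα1 : 0 < 1 - α := by linarith [hα.2]
  have hmix : ∀ s ∈ Set.Icc (0 : ℝ) 1, ∀ ω, 0 ≤ (1 - s) * Q ω + s * Q' ω := fun s hs ω =>
    add_nonneg (mul_nonneg (sub_nonneg.2 hs.2) (hQ ω)) (mul_nonneg hs.1 (hQ' ω))
  have hl : ∀ ω, ContinuousOn (fun s : ℝ => (1 - s) * Q ω + s * Q' ω) (Set.Icc 0 1) :=
    fun ω => by fun_prop
  have hq : ∀ ω, ContinuousOn (fun s : ℝ => ((1 - s) * Q ω + s * Q' ω) ^ (1 - α)) (Set.Icc 0 1) :=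
    fun ω => (hl ω).rpow_const fun s _ => Or.inr hα1.le
  have hc : ContinuousOn (fun s : ℝ => affinity α P (fun ω => (1 - s) * Q ω + s * Q' ω))
      (Set.Icc 0 1) :=
    continuousOn_finsetSum _ fun ω _ => continuousOn_const.mul (hq ω)
  refine ContinuousOn.congr ?_ fun s hs => relEntropy_tilt_eq hα hP (hmix s hs) (hZ s hs)
  refine ContinuousOn.sub (ContinuousOn.div (continuousOn_const.mul ?_) hc fun s hs => (hZ s hs).ne')
    (hc.log fun s hs => (hZ s hs).ne')
  refine continuousOn_finsetSum _ fun ω _ => continuousOn_const.mul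
    ((continuousOn_const.mul (hq ω)).sub ?_)
  exact (continuousOn_rpow_mul_log hα1).comp (hl ω) fun s hs => hmix s hs ω

end Tilting

/-! ### Auxiliary laws with controlled log-likelihood ratios -/

/-- There is a law `V` whose log-likelihood ratios with respect to `Q` and to `P` are bounded by
`r + a` and `e + b`, where `a` and `b` are random variables with mean zero and second moments at
most `s` and `t` under `V`. -/
def HasAuxiliaryLaw {Ω : Type*} [Fintype Ω] (P Q : Ω → ℝ) (r e s t : ℝ) : Prop :=
  ∃ V a b : Ω → ℝ, V ∈ stdSimplex ℝ Ω ∧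
    (∀ ω, V ω ≤ Real.exp (a ω + r) * Q ω) ∧ (∀ ω, V ω ≤ Real.exp (b ω + e) * P ω) ∧
    ∑ ω, V ω * a ω = 0 ∧ ∑ ω, V ω * b ω = 0 ∧
    ∑ ω, V ω * a ω ^ 2 ≤ s ∧ ∑ ω, V ω * b ω ^ 2 ≤ t

section AuxiliaryLaw

variable {Ω : Type*} [Fintype Ω] {P Q Q' : Ω → ℝ} {r r' e e' s s' t t' α : ℝ}

lemma HasAuxiliaryLaw.mono (h : HasAuxiliaryLaw P Q r e s t) (hP : ∀ ω, 0 ≤ P ω)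
    (hQ : ∀ ω, Real.exp r * Q ω ≤ Real.exp r' * Q' ω) (he : e ≤ e') (hs : s ≤ s') (ht : t ≤ t') :
    HasAuxiliaryLaw P Q' r' e' s' t' := by
  obtain ⟨V, a, b, hV, h1, h2, h3, h4, h5, h6⟩ := h
  refine ⟨V, a, b, hV, fun ω => (h1 ω).trans ?_, fun ω => (h2 ω).trans ?_, h3, h4,
    h5.trans hs, h6.trans ht⟩
  · rw [Real.exp_add, Real.exp_add, mul_assoc, mul_assoc]
    exact mul_le_mul_of_nonneg_left (hQ ω) (Real.exp_pos _).le
  · exact mul_le_mul_of_nonneg_right (Real.exp_le_exp.2 (by linarith)) (hP ω)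

lemma le_exp_log_div_mul {v q : ℝ} (hv : 0 < v) (hq : 0 < q) {d r : ℝ} (h : d ≤ r) :
    v ≤ Real.exp (Real.log (v / q) - d + r) * q := by
  have h1 : v = Real.exp (Real.log (v / q)) * q := by
    rw [Real.exp_log (div_pos hv hq)]; field_simp
  refine h1.le.trans (mul_le_mul_of_nonneg_right (Real.exp_le_exp.2 (by linarith)) hq.le)

lemma sum_mul_sub_mean {V f : Ω → ℝ} (hV : V ∈ stdSimplex ℝ Ω) :
    ∑ ω, V ω * (f ω - ∑ ω', V ω' * f ω') = 0 := by
  simp_rw [mul_sub, Finset.sum_sub_distrib, ← Finset.sum_mul, hV.2, one_mul, sub_self]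

lemma sum_mul_sub_mean_sq_le {V f : Ω → ℝ} (hV : V ∈ stdSimplex ℝ Ω) :
    ∑ ω, V ω * (f ω - ∑ ω', V ω' * f ω') ^ 2 ≤ ∑ ω, V ω * f ω ^ 2 := by
  set m := ∑ ω', V ω' * f ω' with hm
  have h : ∑ ω, V ω * (f ω - m) ^ 2 = ∑ ω, V ω * f ω ^ 2 - m ^ 2 := by
    have : ∀ ω, V ω * (f ω - m) ^ 2 = V ω * f ω ^ 2 - 2 * m * (V ω * f ω) + m ^ 2 * V ω :=
      fun ω => by ring
    simp_rw [this, Finset.sum_add_distrib, Finset.sum_sub_distrib, ← Finset.mul_sum, ← hm, hV.2]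
    ring
  rw [h]
  linarith [sq_nonneg m]

lemma hasAuxiliaryLaw_tilt (hα : α ∈ Set.Ioo (0 : ℝ) 1) (hP : P ∈ stdSimplex ℝ Ω)
    (hQ : Q ∈ stdSimplex ℝ Ω) (hZ : 0 < affinity α P Q)
    (hr : relEntropy (tilt α P Q) Q ≤ r) (he : relEntropy (tilt α P Q) P ≤ e) :
    HasAuxiliaryLaw P Q r e (((1 - Real.log (affinity α P Q)) / (1 - α)) ^ 2)
      (((1 - Real.log (affinity α P Q)) / α) ^ 2) := by
  have hV := tilt_mem_stdSimplex (α := α) hP.1 hQ.1 hZ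
  refine ⟨tilt α P Q, fun ω => Real.log (tilt α P Q ω / Q ω) - relEntropy (tilt α P Q) Q,
    fun ω => Real.log (tilt α P Q ω / P ω) - relEntropy (tilt α P Q) P, hV, fun ω => ?_,
    fun ω => ?_, sum_mul_sub_mean hV, sum_mul_sub_mean hV,
    (sum_mul_sub_mean_sq_le hV).trans (sum_tilt_mul_sq_log_le hα hP hQ hZ),
    (sum_mul_sub_mean_sq_le hV).trans ?_⟩
  · by_cases h : tilt α P Q ω = 0
    · rw [h]; exact mul_nonneg (Real.exp_pos _).le (hQ.1 ω)
    · exact le_exp_log_div_mul ((hV.1 ω).lt_of_ne' h) (pos_of_tilt_ne_zero hα hP.1 hQ.1 h).2 hr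
  · by_cases h : tilt α P Q ω = 0
    · rw [h]; exact mul_nonneg (Real.exp_pos _).le (hP.1 ω)
    · exact le_exp_log_div_mul ((hV.1 ω).lt_of_ne' h) (pos_of_tilt_ne_zero hα hP.1 hQ.1 h).1 he
  · have h := sum_tilt_mul_sq_log_le (α := 1 - α) ⟨by linarith [hα.2], by linarith [hα.1]⟩ hQ hP
      (by rwa [affinity_swap])
    rw [affinity_swap, tilt_swap, sub_sub_cancel] at h
    exact h

/-- Laws on two stages, the second of which depends on the outcome of the first, concatenate: the
errors of the second stage are martingale differences, so the second moments add. -/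
lemma HasAuxiliaryLaw.concat {Ω₁ Ω₂ : Type*} [Fintype Ω₁] [Fintype Ω₂] (φ : Ω₁ × Ω₂ ≃ Ω)
    {P₁ Q₁ : Ω₁ → ℝ} {P₂ : Ω₁ → Ω₂ → ℝ} {Q₂ : Ω₂ → ℝ} {r₁ r₂ e₁ e₂ s₁ s₂ t₁ t₂ : ℝ}
    (hP₁ : ∀ u, 0 ≤ P₁ u) (hQ₁ : ∀ u, 0 ≤ Q₁ u)
    (hP : ∀ u v, P (φ (u, v)) = P₁ u * P₂ u v) (hQ : ∀ u v, Q (φ (u, v)) = Q₁ u * Q₂ v)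
    (h₁ : HasAuxiliaryLaw P₁ Q₁ r₁ e₁ s₁ t₁) (h₂ : ∀ u, HasAuxiliaryLaw (P₂ u) Q₂ r₂ e₂ s₂ t₂) :
    HasAuxiliaryLaw P Q (r₁ + r₂) (e₁ + e₂) (s₁ + s₂) (t₁ + t₂) := by
  obtain ⟨V₁, a₁, b₁, hV₁, hq₁, hp₁, ha₁, hb₁, hs₁, ht₁⟩ := h₁
  choose V₂ a₂ b₂ hV₂ hq₂ hp₂ ha₂ hb₂ hs₂ ht₂ using h₂
  have hsum : ∀ f : Ω → ℝ, ∑ ω, f ω = ∑ u, ∑ v, f (φ (u, v)) := fun f => by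
    rw [← φ.sum_comp, Fintype.sum_prod_type]
  have hmean : ∀ (f : Ω₁ → ℝ) (g : Ω₁ → Ω₂ → ℝ), ∑ u, V₁ u * f u = 0 →
      (∀ u, ∑ v, V₂ u v * g u v = 0) →
      ∑ u, ∑ v, V₁ u * V₂ u v * (f u + g u v) = 0 := by
    intro f g hf hg
    rw [← hf]
    refine Finset.sum_congr rfl fun u _ => ?_
    have : ∀ v, V₁ u * V₂ u v * (f u + g u v) =
        V₁ u * f u * V₂ u v + V₁ u * (V₂ u v * g u v) := fun v => by ring
    simp_rw [this, Finset.sum_add_distrib, ← Finset.mul_sum, (hV₂ u).2, hg u]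
    ring
  have hsq : ∀ (f : Ω₁ → ℝ) (g : Ω₁ → Ω₂ → ℝ) (c d : ℝ), ∑ u, V₁ u * f u ^ 2 ≤ c →
      (∀ u, ∑ v, V₂ u v * g u v = 0) → (∀ u, ∑ v, V₂ u v * g u v ^ 2 ≤ d) →
      ∑ u, ∑ v, V₁ u * V₂ u v * (f u + g u v) ^ 2 ≤ c + d := by
    intro f g c d hf hg hg2
    have : ∀ u, ∑ v, V₁ u * V₂ u v * (f u + g u v) ^ 2 =
        V₁ u * f u ^ 2 + V₁ u * ∑ v, V₂ u v * g u v ^ 2 := by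
      intro u
      have : ∀ v, V₁ u * V₂ u v * (f u + g u v) ^ 2 = V₁ u * f u ^ 2 * V₂ u v +
          2 * V₁ u * f u * (V₂ u v * g u v) + V₁ u * (V₂ u v * g u v ^ 2) := fun v => by ring
      simp_rw [this, Finset.sum_add_distrib, ← Finset.mul_sum, (hV₂ u).2, hg u]
      ring
    simp_rw [this, Finset.sum_add_distrib]
    have h2 : ∑ u, V₁ u * ∑ v, V₂ u v * g u v ^ 2 ≤ ∑ u, V₁ u * d :=
      Finset.sum_le_sum fun u _ => mul_le_mul_of_nonneg_left (hg2 u) (hV₁.1 u)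
    rw [← Finset.sum_mul, hV₁.2, one_mul] at h2
    exact add_le_add hf h2
  have hbd : ∀ (u : Ω₁) (v : Ω₂) (x y z w p q : ℝ), 0 ≤ p → V₁ u ≤ Real.exp (x + y) * p →
      V₂ u v ≤ Real.exp (z + w) * q →
      V₁ u * V₂ u v ≤ Real.exp (x + z + (y + w)) * (p * q) := by
    intro u v x y z w p q hp h1 h2
    refine (mul_le_mul h1 h2 ((hV₂ u).1 v) (mul_nonneg (Real.exp_pos _).le hp)).trans (le_of_eq ?_)
    rw [add_add_add_comm, Real.exp_add (x + y)]; ring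
  refine ⟨fun ω => V₁ (φ.symm ω).1 * V₂ (φ.symm ω).1 (φ.symm ω).2,
    fun ω => a₁ (φ.symm ω).1 + a₂ (φ.symm ω).1 (φ.symm ω).2,
    fun ω => b₁ (φ.symm ω).1 + b₂ (φ.symm ω).1 (φ.symm ω).2,
    ⟨fun ω => mul_nonneg (hV₁.1 _) ((hV₂ _).1 _), ?_⟩, fun ω => ?_, fun ω => ?_, ?_, ?_, ?_, ?_⟩
  · rw [hsum]
    simp only [Equiv.symm_apply_apply, ← Finset.mul_sum, (hV₂ _).2, mul_one]
    exact hV₁.2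
  · obtain ⟨⟨u, v⟩, rfl⟩ := φ.surjective ω
    rw [hQ]
    simp only [Equiv.symm_apply_apply]
    exact hbd u v _ _ _ _ _ _ (hQ₁ u) (hq₁ u) (hq₂ u v)
  · obtain ⟨⟨u, v⟩, rfl⟩ := φ.surjective ω
    rw [hP]
    simp only [Equiv.symm_apply_apply]
    exact hbd u v _ _ _ _ _ _ (hP₁ u) (hp₁ u) (hp₂ u v)
  · rw [hsum]
    simp only [Equiv.symm_apply_apply]
    exact hmean a₁ a₂ ha₁ ha₂
  · rw [hsum]
    simp only [Equiv.symm_apply_apply]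
    exact hmean b₁ b₂ hb₁ hb₂
  · rw [hsum]
    simp only [Equiv.symm_apply_apply]
    exact hsq a₁ a₂ _ _ hs₁ ha₂ hs₂
  · rw [hsum]
    simp only [Equiv.symm_apply_apply]
    exact hsq b₁ b₂ _ _ ht₁ hb₂ ht₂

/-- Chebyshev's inequality on a finite set. -/
lemma sum_filter_lt_le_quarter {V a : Ω → ℝ} (hV : ∀ ω, 0 ≤ V ω) {d : ℝ} (hd : 0 < d)
    (ha : ∑ ω, V ω * a ω ^ 2 ≤ s) (hs : 4 * s ≤ d ^ 2) :
    ∑ ω with d < a ω, V ω ≤ 1 / 4 := by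
  have h : d ^ 2 * ∑ ω with d < a ω, V ω ≤ ∑ ω, V ω * a ω ^ 2 := by
    rw [Finset.mul_sum]
    refine (Finset.sum_le_sum (g := fun ω => V ω * a ω ^ 2) fun ω hω => ?_).trans
      (Finset.sum_le_sum_of_subset_of_nonneg (Finset.filter_subset _ _)
        fun ω _ _ => mul_nonneg (hV ω) (sq_nonneg _))
    have hda := (Finset.mem_filter.1 hω).2
    have := pow_le_pow_left₀ hd.le hda.le 2
    nlinarith [hV ω]
  have hd2 : 0 < d ^ 2 := by positivity
  by_contra! hc
  nlinarith

/-- If `Q` gives little mass to a set `T`, then `P` gives its complement a mass that is not much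
smaller than `exp (-e)`: on the event of `V`-probability at least one half where neither
log-likelihood ratio exceeds its mean by two standard deviations, `V` is comparable to both. -/
lemma HasAuxiliaryLaw.exp_mul_le (h : HasAuxiliaryLaw P Q r e s t) (hP : ∀ ω, 0 ≤ P ω)
    (hQ : ∀ ω, 0 ≤ Q ω) {d d' : ℝ} (hd : 0 < d) (hd' : 0 < d') (hs : 4 * s ≤ d ^ 2)
    (ht : 4 * t ≤ d' ^ 2) (T : Ω → Prop) [DecidablePred T] :
    Real.exp (-(d' + e)) * (1 / 2 - Real.exp (d + r) * ∑ ω with T ω, Q ω) ≤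
      ∑ ω with ¬ T ω, P ω := by
  obtain ⟨V, a, b, hV, h1, h2, -, -, h5, h6⟩ := h
  have ha := sum_filter_lt_le_quarter hV.1 hd h5 hs
  have hb := sum_filter_lt_le_quarter hV.1 hd' h6 ht
  have hpt : ∀ ω, V ω ≤ (if d < a ω then V ω else 0) + (if d' < b ω then V ω else 0) +
      (if T ω then Real.exp (d + r) * Q ω else 0) +
      (if ¬ T ω then Real.exp (d' + e) * P ω else 0) := by
    intro ω
    have hv := hV.1 ω
    have hq := mul_nonneg (Real.exp_pos (d + r)).le (hQ ω)
    have hp := mul_nonneg (Real.exp_pos (d' + e)).le (hP ω)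
    by_cases hda : d < a ω
    · rw [if_pos hda]; split_ifs <;> linarith
    by_cases hdb : d' < b ω
    · rw [if_pos hdb]; split_ifs <;> linarith
    have h3 := (h1 ω).trans (mul_le_mul_of_nonneg_right
      (Real.exp_le_exp.2 (by linarith : a ω + r ≤ d + r)) (hQ ω))
    have h4 := (h2 ω).trans (mul_le_mul_of_nonneg_right
      (Real.exp_le_exp.2 (by linarith : b ω + e ≤ d' + e)) (hP ω))
    by_cases hT : T ω
    · simp [hda, hdb, hT, h3]
    · simp [hda, hdb, hT, h4]
  have hsum := Finset.sum_le_sum fun ω (_ : ω ∈ Finset.univ) => hpt ω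
  simp only [Finset.sum_add_distrib, ← Finset.sum_filter, ← Finset.mul_sum, hV.2] at hsum
  have h7 : 1 / 2 - Real.exp (d + r) * ∑ ω with T ω, Q ω ≤
      Real.exp (d' + e) * ∑ ω with ¬ T ω, P ω := by linarith
  calc _ ≤ Real.exp (-(d' + e)) * (Real.exp (d' + e) * ∑ ω with ¬ T ω, P ω) :=
        mul_le_mul_of_nonneg_left h7 (Real.exp_pos _).le
    _ = _ := by rw [← mul_assoc, ← Real.exp_add]; simp

end AuxiliaryLaw

/-! ### Choosing the tilted law along a net of orders -/

/-- Along the net of orders `η 0 ≤ … ≤ η N`, with a pmf `Q i` for each of them, there is a tilted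
law `V` with `D(V‖Q') ≤ r` and `D(V‖P) ≤ e` for some convex combination `Q'` of the `Q i`. If
`D(V‖Q i) ≤ r` at every point of the net, the last point does. Otherwise the pairs (order, pmf)
are moved continuously past the first violation, the order first and the pmf afterwards, and at a
point where `D(V‖Q') = r` the bound on the affinity gives `D(V‖P) ≤ e`. -/
lemma exists_tilt_of_net {Ω : Type*} [Fintype Ω] {P : Ω → ℝ} (hP : P ∈ stdSimplex ℝ Ω)
    {N : ℕ} {η : ℕ → ℝ} {Q : ℕ → Ω → ℝ} {r e B : ℝ}
    (hη : ∀ i ≤ N, η i ∈ Set.Ioo (0 : ℝ) 1) (hmono : ∀ i < N, η i ≤ η (i + 1))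
    (hQ : ∀ i ≤ N, Q i ∈ stdSimplex ℝ Ω)
    (hB : ∀ i ≤ N, Real.exp (-B) ≤ affinity (η i) P (Q i))
    (h_net : ∀ i ≤ N, Real.exp (-(η i * e + (1 - η i) * r)) ≤ affinity (η i) P (Q i))
    (hB_order : ∀ i < N, ∀ α ∈ Set.Icc (η i) (η (i + 1)), Real.exp (-B) ≤ affinity α P (Q i))
    (h_order : ∀ i < N, ∀ α ∈ Set.Icc (η i) (η (i + 1)),
      Real.exp (-(α * e + (1 - α) * r)) ≤ affinity α P (Q i))
    (h_first : Real.exp (-((1 - η 0) * r)) ≤ affinity (η 0) P (Q 0))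
    (h_last : Real.exp (-(η N * e)) ≤ affinity (η N) P (Q N)) :
    ∃ α Q', α ∈ Set.Icc (η 0) (η N) ∧ Q' ∈ stdSimplex ℝ Ω ∧
      (∀ ω, Q' ω ≤ ∑ i ∈ Finset.range (N + 1), Q i ω) ∧ Real.exp (-B) ≤ affinity α P Q' ∧
      relEntropy (tilt α P Q') Q' ≤ r ∧ relEntropy (tilt α P Q') P ≤ e := by
  have hle : ∀ i ≤ N, η 0 ≤ η i := by
    intro i hi
    induction i with
    | zero => exact le_rfl
    | succ i ih => exact (ih (by omega)).trans (hmono i (by omega))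
  have hge : ∀ k, ∀ i ≤ N, N - i = k → η i ≤ η N := by
    intro k
    induction k with
    | zero => intro i hi hk; rw [show i = N by omega]
    | succ k ih => intro i hi hk; exact (hmono i (by omega)).trans (ih (i + 1) (by omega) (by omega))
  have hQsum : ∀ i ≤ N, ∀ ω, Q i ω ≤ ∑ i ∈ Finset.range (N + 1), Q i ω := fun i hi ω =>
    Finset.single_le_sum (f := fun i => Q i ω)
      (fun j hj => (hQ j (by simpa [Nat.lt_succ_iff] using hj)).1 ω)
      (Finset.mem_range.2 (by omega))
  have hfin : ∀ α Q', α ∈ Set.Ioo (0 : ℝ) 1 → Q' ∈ stdSimplex ℝ Ω →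
      Real.exp (-(α * e + (1 - α) * r)) ≤ affinity α P Q' →
      relEntropy (tilt α P Q') Q' = r → relEntropy (tilt α P Q') P ≤ e := by
    intro α Q' hα hQ' hZ hr
    have hZ0 := (Real.exp_pos _).trans_le hZ
    have h1 := relEntropy_tilt_add hα hP.1 hQ'.1 hZ0
    have h2 := (Real.le_log_iff_exp_le hZ0).2 hZ
    rw [hr] at h1
    exact le_of_mul_le_mul_left (by linarith) hα.1
  by_cases hall : ∀ i ≤ N, relEntropy (tilt (η i) P (Q i)) (Q i) ≤ r
  · exact ⟨η N, Q N, ⟨hle N le_rfl, le_rfl⟩, hQ N le_rfl, hQsum N le_rfl, hB N le_rfl,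
      hall N le_rfl, relEntropy_tilt_right_le (hη N le_rfl) hP (hQ N le_rfl) h_last⟩
  classical
  push Not at hall
  obtain ⟨i, ⟨hiN, hir⟩, hmin⟩ : ∃ i, (i ≤ N ∧ r < relEntropy (tilt (η i) P (Q i)) (Q i)) ∧
      ∀ j < i, ¬ (j ≤ N ∧ r < relEntropy (tilt (η j) P (Q j)) (Q j)) :=
    ⟨Nat.find hall, Nat.find_spec hall, fun j hj => Nat.find_min hall hj⟩
  have h0 := relEntropy_tilt_left_le (hη 0 (by omega)) hP (hQ 0 (by omega)) h_first
  obtain _ | j := i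
  · exact absurd h0 (not_le.2 hir)
  have hjr : relEntropy (tilt (η j) P (Q j)) (Q j) ≤ r := by
    by_contra! hc
    exact hmin j (by omega) ⟨by omega, hc⟩
  have hjN : j < N := by omega
  have hsub : Set.Icc (η j) (η (j + 1)) ⊆ Set.Ioo 0 1 := fun x hx =>
    ⟨(hη j (by omega)).1.trans_le hx.1, hx.2.trans_lt (hη (j + 1) hiN).2⟩
  rcases lt_or_ge r (relEntropy (tilt (η (j + 1)) P (Q j)) (Q j)) with hc | hc
  · obtain ⟨α, hα, hαr⟩ := intermediate_value_Icc (hmono j hjN)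
      (continuousOn_relEntropy_tilt_order hsub hP.1 (hQ j (by omega)).1
        fun α hα => (Real.exp_pos _).trans_le (hB_order j hjN α hα)) ⟨hjr, hc.le⟩
    exact ⟨α, Q j, ⟨(hle j (by omega)).trans hα.1, hα.2.trans (hge _ (j + 1) hiN rfl)⟩,
      hQ j (by omega), hQsum j (by omega), hB_order j hjN α hα, hαr.le,
      hfin α (Q j) (hsub hα) (hQ j (by omega)) (h_order j hjN α hα) hαr⟩
  · have hα := hη (j + 1) hiN
    have hmem : η (j + 1) ∈ Set.Icc (η j) (η (j + 1)) := ⟨hmono j hjN, le_rfl⟩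
    have hmix : ∀ s ∈ Set.Icc (0 : ℝ) 1, ∀ c, Real.exp (-c) ≤ affinity (η (j + 1)) P (Q j) →
        Real.exp (-c) ≤ affinity (η (j + 1)) P (Q (j + 1)) → Real.exp (-c) ≤
        affinity (η (j + 1)) P (fun ω => (1 - s) * Q j ω + s * Q (j + 1) ω) := fun s hs c h1 h2 =>
      (le_min h1 h2).trans
        (min_le_affinity_mix hα hP.1 (hQ j (by omega)).1 (hQ (j + 1) hiN).1 hs)
    have hBmix := fun s hs => hmix s hs B (hB_order j hjN _ hmem) (hB (j + 1) hiN)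
    have hcont := continuousOn_relEntropy_tilt_mix hα hP.1 (hQ j (by omega)).1 (hQ (j + 1) hiN).1
      fun s hs => (Real.exp_pos _).trans_le (hBmix s hs)
    obtain ⟨s, hs, hsr⟩ := intermediate_value_Icc zero_le_one hcont
      (show r ∈ Set.Icc _ _ from ⟨by simpa using hc, by simpa using hir.le⟩)
    have hQs : (fun ω => (1 - s) * Q j ω + s * Q (j + 1) ω) ∈ stdSimplex ℝ Ω :=
      convex_stdSimplex ℝ Ω (hQ j (by omega)) (hQ (j + 1) hiN) (sub_nonneg.2 hs.2) hs.1 (by ring)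
    refine ⟨η (j + 1), fun ω => (1 - s) * Q j ω + s * Q (j + 1) ω,
      ⟨hle _ hiN, hge _ _ hiN rfl⟩, hQs, fun ω => ?_, hBmix s hs, hsr.le,
      hfin _ _ hα hQs (hmix s hs _ (h_order j hjN _ hmem) (h_net (j + 1) hiN)) hsr⟩
    have h1 := hQsum j (by omega) ω
    have h2 := hQsum (j + 1) hiN ω
    nlinarith [hs.1, hs.2]

/-! ### Rényi centers and the dependence of the capacity on the order -/

lemma coe_mem_stdSimplex {X : Type*} [Fintype X] (p : stdSimplex ℝ X) :
    (p : X → ℝ) ∈ stdSimplex ℝ X := p.2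

section Capacity

variable {X Y : Type*} [Fintype X] [Fintype Y] {W : X → stdSimplex ℝ Y} {α η : ℝ}

/-- For every order `α ∈ (0, 1)` there is a pmf, the Rényi center, whose order-`α` divergence from
every row of the channel is at most the capacity. It is proportional to `a^(1/α)`, where
`a y = ∑ p x * W x y ^ α` for a prior `p` that attains the capacity; the bounds are the first order
optimality conditions for `p` in the directions of the vertices of the simplex. -/
lemma exists_renyi_center [Nonempty X] (W : X → stdSimplex ℝ Y) (hα : α ∈ Set.Ioo (0 : ℝ) 1) :
    ∃ q ∈ stdSimplex ℝ Y, ∀ x,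
      Real.exp (-((1 - α) * renyiCapacity α W)) ≤ affinity α (W x) q := by
  classical
  have hα0 := hα.1
  have hα1 : 0 < 1 - α := by linarith [hα.2]
  have hinv : 1 ≤ 1 / α := by rw [le_div_iff₀ hα0]; linarith [hα.2]
  have hWα : ∀ x y, 0 ≤ W x y ^ α := fun x y => Real.rpow_nonneg ((W x).2.1 y) _
  set F : stdSimplex ℝ X → ℝ := fun p => ∑ y, (∑ x, p x * W x y ^ α) ^ (1 / α) with hF
  have hcont : Continuous F := by
    refine continuous_finsetSum _ fun y _ => Continuous.rpow_const ?_ fun _ => Or.inr (by positivity)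
    exact continuous_finsetSum _ fun x _ =>
      ((continuous_apply x).comp continuous_subtype_val).mul continuous_const
  have hnn : ∀ (p : stdSimplex ℝ X) y, 0 ≤ ∑ x, p x * W x y ^ α := fun p y =>
    Finset.sum_nonneg fun x _ => mul_nonneg (p.2.1 x) (hWα x y)
  have hFpos : ∀ p, 0 < F p := by
    intro p
    have h1 : ∑ y, ∑ x, p x * W x y = 1 := by
      rw [Finset.sum_comm]
      simp_rw [← Finset.mul_sum]
      simp_rw [stdSimplex.sum_eq_one, mul_one]
      exact p.2.2
    have h2 : 0 < ∑ y, ∑ x, p x * W x y := by rw [h1]; exact one_pos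
    obtain ⟨y, -, hy⟩ := Finset.exists_lt_of_sum_lt (s := Finset.univ) (f := fun _ : Y => (0 : ℝ))
      (by simpa using h2)
    obtain ⟨x, -, hx⟩ := Finset.exists_lt_of_sum_lt (s := Finset.univ) (f := fun _ : X => (0 : ℝ))
      (by simpa using hy)
    have hpx : 0 < p x := (p.2.1 x).lt_of_ne' fun h => by
      have h' : p x = 0 := h
      simp [h'] at hx
    have hWx : 0 < W x y := pos_of_mul_pos_right hx hpx.le
    have hay : 0 < ∑ x, p x * W x y ^ α := Finset.sum_pos' (fun x _ =>
      mul_nonneg (p.2.1 x) (hWα x y)) ⟨x, Finset.mem_univ _, mul_pos hpx (Real.rpow_pos_of_pos hWx _)⟩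
    exact Finset.sum_pos' (fun y _ => Real.rpow_nonneg (hnn p y) _)
      ⟨y, Finset.mem_univ _, Real.rpow_pos_of_pos hay _⟩
  have hI : ∀ p, renyiInformation α p W = α / (α - 1) * Real.log (F p) := fun p => by
    rw [renyiInformation, if_neg hα.2.ne]
  obtain ⟨p, -, hp⟩ := isCompact_univ.exists_isMinOn Set.univ_nonempty hcont.continuousOn
  have hmin : ∀ p', F p ≤ F p' := fun p' => hp (Set.mem_univ p')
  have hIle : ∀ p', renyiInformation α p' W ≤ renyiInformation α p W := by
    intro p'
    rw [hI, hI]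
    exact mul_le_mul_of_nonpos_left (Real.log_le_log (hFpos p) (hmin p'))
      (div_nonpos_of_nonneg_of_nonpos hα0.le (by linarith))
  have hC : renyiCapacity α W = α / (α - 1) * Real.log (F p) := by
    rw [← hI]
    exact le_antisymm (ciSup_le hIle) (le_ciSup ⟨_, by rintro _ ⟨p', rfl⟩; exact hIle p'⟩ p)
  set a : Y → ℝ := fun y => ∑ x, p x * W x y ^ α with ha
  have ha0 : ∀ y, 0 ≤ a y := hnn p
  have hFa : F p = ∑ y, a y ^ (1 / α) := rfl
  -- The derivative of `F` at `p` towards the vertex `x` is nonnegative.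
  have hderiv : ∀ x, F p ≤ ∑ y, W x y ^ α * a y ^ (1 / α - 1) := by
    intro x
    have hd : HasDerivAt (fun t : ℝ => ∑ y, (a y + t * (W x y ^ α - a y)) ^ (1 / α))
        (∑ y, (W x y ^ α - a y) * (1 / α) * a y ^ (1 / α - 1)) 0 := by
      refine HasDerivAt.fun_sum fun y _ => ?_
      have h1 : HasDerivAt (fun t : ℝ => a y + t * (W x y ^ α - a y)) (W x y ^ α - a y) 0 := by
        simpa using ((hasDerivAt_id (0 : ℝ)).mul_const (W x y ^ α - a y)).const_add (a y)
      simpa using h1.rpow_const (p := 1 / α) (Or.inr hinv)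
    have hlim := hd.tendsto_slope_zero_right
    have hge : 0 ≤ ∑ y, (W x y ^ α - a y) * (1 / α) * a y ^ (1 / α - 1) := by
      refine ge_of_tendsto hlim ?_
      filter_upwards [Ioo_mem_nhdsGT (zero_lt_one (α := ℝ))] with t ht
      refine smul_nonneg (inv_nonneg.2 ht.1.le) (sub_nonneg.2 ?_)
      have hvert : Pi.single x (1 : ℝ) ∈ stdSimplex ℝ X := single_mem_stdSimplex ℝ x
      have hp' := convex_stdSimplex ℝ X p.2 hvert (sub_nonneg.2 ht.2.le) ht.1.le (by ring)
      have hm := hmin ⟨_, hp'⟩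
      have hl : F p = ∑ y, (a y + 0 * (W x y ^ α - a y)) ^ (1 / α) := by simp [hFa]
      rw [zero_add, ← hl]
      refine hm.trans (le_of_eq (Finset.sum_congr rfl fun y _ => ?_))
      congr 1
      have : ∀ z, ((1 - t) • (p : X → ℝ) + t • (Pi.single x (1 : ℝ) : X → ℝ)) z * W z y ^ α =
          (1 - t) * (p z * W z y ^ α) + t * ((Pi.single x (1 : ℝ) : X → ℝ) z * W z y ^ α) := fun z => by
        simp only [Pi.add_apply, Pi.smul_apply, smul_eq_mul]
        ring
      calc _ = ∑ z, ((1 - t) * (p z * W z y ^ α) + t * ((Pi.single x (1 : ℝ) : X → ℝ) z * W z y ^ α)) :=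
            Finset.sum_congr rfl fun z _ => this z
        _ = _ := by
          rw [Finset.sum_add_distrib, ← Finset.mul_sum, ← Finset.mul_sum]
          simp only [Pi.single_apply, ite_mul, one_mul, zero_mul, Finset.sum_ite_eq',
            Finset.mem_univ, if_true]
          change (1 - t) * a y + _ = _
          ring
    have hsplit : ∑ y, (W x y ^ α - a y) * (1 / α) * a y ^ (1 / α - 1) =
        1 / α * (∑ y, W x y ^ α * a y ^ (1 / α - 1) - F p) := by
      rw [hFa, ← Finset.sum_sub_distrib, Finset.mul_sum]
      refine Finset.sum_congr rfl fun y _ => ?_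
      have : a y ^ (1 / α) = a y * a y ^ (1 / α - 1) := by
        rw [← Real.rpow_one_add' (ha0 y) (by linarith)]
        congr 1; ring
      rw [this]; ring
    rw [hsplit] at hge
    by_contra! hc
    have hpos : 0 < 1 / α := by positivity
    nlinarith
  refine ⟨fun y => a y ^ (1 / α) / F p,
    ⟨fun y => div_nonneg (Real.rpow_nonneg (ha0 y) _) (hFpos p).le, ?_⟩, fun x => ?_⟩
  · rw [← Finset.sum_div, ← hFa, div_self (hFpos p).ne']
  · have hexp : Real.exp (-((1 - α) * renyiCapacity α W)) = F p ^ α := by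
      rw [hC, Real.rpow_def_of_pos (hFpos p)]
      congr 1
      have : α - 1 ≠ 0 := by linarith
      field_simp
      ring
    have haff : affinity α (W x) (fun y => a y ^ (1 / α) / F p) =
        (∑ y, W x y ^ α * a y ^ (1 / α - 1)) / F p ^ (1 - α) := by
      unfold affinity
      rw [Finset.sum_div]
      refine Finset.sum_congr rfl fun y _ => ?_
      rw [Real.div_rpow (Real.rpow_nonneg (ha0 y) _) (hFpos p).le, ← Real.rpow_mul (ha0 y),
        show 1 / α * (1 - α) = 1 / α - 1 by field_simp, mul_div_assoc]
    rw [hexp, haff, le_div_iff₀ (Real.rpow_pos_of_pos (hFpos p) _),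
      ← Real.rpow_add (hFpos p), show α + (1 - α) = 1 by ring, Real.rpow_one]
    exact hderiv x

/-- The order-`α` capacity is at most the order-`α` divergence radius about any pmf `q`. -/
lemma renyiCapacity_le [Nonempty X] (hα : α ∈ Set.Ioo (0 : ℝ) 1) {q : Y → ℝ}
    (hq : q ∈ stdSimplex ℝ Y) {c : ℝ}
    (h : ∀ x, Real.exp (-((1 - α) * c)) ≤ affinity α (W x) q) : renyiCapacity α W ≤ c := by
  refine ciSup_le fun p => ?_
  have hα0 := hα.1
  have hα1 : 0 < 1 - α := by linarith [hα.2]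
  rw [renyiInformation, if_neg hα.2.ne]
  have ha0 : ∀ y, 0 ≤ ∑ x, p x * W x y ^ α := fun y => Finset.sum_nonneg fun x _ =>
    mul_nonneg (p.2.1 x) (Real.rpow_nonneg ((W x).2.1 y) _)
  have h1 : Real.exp (-((1 - α) * c)) ≤ ∑ y, (∑ x, p x * W x y ^ α) * q y ^ (1 - α) := by
    have h2 : ∑ x, p x * Real.exp (-((1 - α) * c)) ≤ ∑ x, p x * affinity α (W x) q :=
      Finset.sum_le_sum fun x _ => mul_le_mul_of_nonneg_left (h x) (p.2.1 x)
    have h3 : ∑ x, p x = 1 := p.2.2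
    rw [← Finset.sum_mul, h3, one_mul] at h2
    refine h2.trans (le_of_eq ?_)
    simp_rw [affinity, Finset.mul_sum, Finset.sum_mul]
    rw [Finset.sum_comm]
    simp_rw [mul_assoc]
  have h2 := Real.inner_le_Lp_mul_Lq_of_nonneg Finset.univ (p := 1 / α) (q := 1 / (1 - α))
    (f := fun y => ∑ x, p x * W x y ^ α) (g := fun y => q y ^ (1 - α))
    (by rw [Real.holderConjugate_iff]; exact ⟨by rw [lt_div_iff₀ hα0]; linarith [hα.2], by simp⟩)
    (fun y _ => ha0 y) (fun y _ => Real.rpow_nonneg (hq.1 y) _)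
  have h3 : ∑ y, (q y ^ (1 - α)) ^ (1 / (1 - α)) = 1 := by
    refine (Finset.sum_congr rfl fun y _ => ?_).trans hq.2
    rw [← Real.rpow_mul (hq.1 y), mul_one_div_cancel hα1.ne', Real.rpow_one]
  rw [h3, Real.one_rpow, mul_one, one_div_one_div] at h2
  have h4 := h1.trans h2
  have hF0 : 0 ≤ ∑ y, (∑ x, p x * W x y ^ α) ^ (1 / α) :=
    Finset.sum_nonneg fun y _ => Real.rpow_nonneg (ha0 y) _
  have hF : 0 < ∑ y, (∑ x, p x * W x y ^ α) ^ (1 / α) := hF0.lt_of_ne fun h0 => by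
    rw [← h0, Real.zero_rpow hα0.ne'] at h4
    exact absurd h4 (not_le.2 (Real.exp_pos _))
  have h5 := (Real.le_log_iff_exp_le (Real.rpow_pos_of_pos hF _)).2 h4
  rw [Real.log_rpow hF] at h5
  have hneg : α - 1 = -(1 - α) := by ring
  rw [hneg, div_neg, neg_mul, div_mul_eq_mul_div, neg_le, le_div_iff₀ hα1]
  linarith

lemma renyiCapacity_nonneg [Nonempty X] (hα : α ∈ Set.Ioo (0 : ℝ) 1) : 0 ≤ renyiCapacity α W := by
  obtain ⟨q, hq, h⟩ := exists_renyi_center W hα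
  have x : X := Classical.arbitrary X
  have h1 := (h x).trans (affinity_le_one hα (W x).2 hq)
  rw [Real.exp_le_one_iff] at h1
  have : 0 < 1 - α := by linarith [hα.2]
  by_contra! hc
  nlinarith

lemma renyiCapacity_mono [Nonempty X] (hη : 0 < η) (hηα : η ≤ α) (hα : α < 1) :
    renyiCapacity η W ≤ renyiCapacity α W := by
  obtain ⟨q, hq, h⟩ := exists_renyi_center W ⟨hη.trans_le hηα, hα⟩
  refine renyiCapacity_le ⟨hη, hηα.trans_lt hα⟩ hq fun x => ?_
  have hx := h x
  rw [← affinity_swap] at hx ⊢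
  have := exp_neg_le_affinity_of_le (by linarith : 0 < 1 - α) (by linarith : 1 - α ≤ 1 - η)
    (by linarith) hq.1 (coe_mem_stdSimplex (W x)) hx
  have h1 : 1 - α ≠ 0 := by linarith
  convert this using 3
  field_simp

lemma renyiCapacity_scaled_anti [Nonempty X] (hη : 0 < η) (hηα : η ≤ α) (hα : α < 1) :
    (1 - α) / α * renyiCapacity α W ≤ (1 - η) / η * renyiCapacity η W := by
  obtain ⟨q, hq, h⟩ := exists_renyi_center W ⟨hη, hηα.trans_lt hα⟩
  have hα0 : 0 < α := hη.trans_le hηα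
  have hα1 : 0 < 1 - α := by linarith
  have hle : renyiCapacity α W ≤ α / (1 - α) * ((1 - η) / η * renyiCapacity η W) := by
    refine renyiCapacity_le ⟨hα0, hα⟩ hq fun x => ?_
    convert exp_neg_le_affinity_of_le hη hηα hα (coe_mem_stdSimplex (W x)).1 hq (h x) using 3
    field_simp
  calc _ ≤ (1 - α) / α * (α / (1 - α) * ((1 - η) / η * renyiCapacity η W)) :=
        mul_le_mul_of_nonneg_left hle (by positivity)
    _ = _ := by field_simp

/-- Up to the factor `1 - α`, all capacities are controlled by the one of order `1/2`. -/
lemma one_sub_mul_renyiCapacity_le [Nonempty X] (hα : α ∈ Set.Ioo (0 : ℝ) 1) :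
    (1 - α) * renyiCapacity α W ≤ renyiCapacity (1 / 2) W := by
  have h0 := renyiCapacity_nonneg (W := W) hα
  rcases le_total α (1 / 2) with h | h
  · have := renyiCapacity_mono (W := W) hα.1 h (by norm_num)
    nlinarith [hα.1]
  · have h1 := renyiCapacity_scaled_anti (W := W) (by norm_num) h hα.2
    have h2 : (1 - α) * renyiCapacity α W ≤ (1 - α) / α * renyiCapacity α W := by
      refine mul_le_mul_of_nonneg_right ?_ h0
      rw [le_div_iff₀ hα.1]
      nlinarith [hα.1, hα.2]
    norm_num at h1
    exact h2.trans (by norm_num; exact h1)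

end Capacity

/-! ### Feedback products and their decomposition into blocks -/

section Feedback

variable {X Y : Type*} {m l n : ℕ}

/-- The product of the weights `g` along the output string `y`, the inputs being chosen by the
feedback input `x`. -/
def feedbackProd (g : X → Y → ℝ) (x : FeedbackInput n X Y) (y : Fin n → Y) : ℝ :=
  ∏ t : Fin n, g (x t fun s : Fin (t : ℕ) => y (Fin.castLE t.isLt.le s)) (y t)

/-- The first `m` inputs of a feedback input of length `m + l`. -/
def feedbackPrefix (x : FeedbackInput (m + l) X Y) : FeedbackInput m X Y :=
  fun t past => x (Fin.castAdd l t) past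

/-- The feedback input that governs the last `l` instants once the first `m` outputs are `u`. -/
def feedbackSuffix (x : FeedbackInput (m + l) X Y) (u : Fin m → Y) : FeedbackInput l X Y :=
  fun t past => x (Fin.natAdd m t) (Fin.append u past)

lemma feedbackProd_append (g : X → Y → ℝ) (x : FeedbackInput (m + l) X Y) (u : Fin m → Y)
    (v : Fin l → Y) : feedbackProd g x (Fin.append u v) =
      feedbackProd g (feedbackPrefix x) u * feedbackProd g (feedbackSuffix x u) v := by
  unfold feedbackProd
  rw [Fin.prod_univ_add]
  congr 1
  · refine Finset.prod_congr rfl fun t _ => ?_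
    have h : (fun s : Fin (t : ℕ) =>
        Fin.append u v (Fin.castLE (Fin.castAdd l t).isLt.le s)) =
        fun s => u (Fin.castLE t.isLt.le s) := by
      funext s
      exact Fin.append_left u v (Fin.castLE t.isLt.le s)
    rw [Fin.append_left]
    exact congrArg (fun p => g (x (Fin.castAdd l t) p) (u t)) h
  · refine Finset.prod_congr rfl fun t _ => ?_
    have h : (fun s : Fin (m + (t : ℕ)) =>
        Fin.append u v (Fin.castLE (Fin.natAdd m t).isLt.le s)) =
        Fin.append u fun s => v (Fin.castLE t.isLt.le s) := by
      funext s
      induction s using Fin.addCases with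
      | left s =>
        rw [Fin.append_left]
        exact Fin.append_left u v s
      | right s =>
        rw [Fin.append_right]
        exact Fin.append_right u v (Fin.castLE t.isLt.le s)
    rw [Fin.append_right]
    exact congrArg (fun p => g (x (Fin.natAdd m t) p) (v t)) h

variable [Fintype Y]

lemma sum_append (f : (Fin (m + l) → Y) → ℝ) :
    ∑ y, f y = ∑ u : Fin m → Y, ∑ v : Fin l → Y, f (Fin.append u v) := by
  rw [← (Fin.appendEquiv m l).sum_comp, Fintype.sum_prod_type]
  rfl

lemma sum_feedbackProd_succ (g : X → Y → ℝ) (x : FeedbackInput (n + 1) X Y) :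
    ∑ y, feedbackProd g x y =
      ∑ u, feedbackProd g (feedbackPrefix x) u * ∑ y, g (x (Fin.last n) u) y := by
  rw [sum_append]
  refine Finset.sum_congr rfl fun u _ => ?_
  simp_rw [feedbackProd_append, ← Finset.mul_sum]
  congr 1
  rw [← (Equiv.funUnique (Fin 1) Y).symm.sum_comp]
  refine Finset.sum_congr rfl fun y _ => ?_
  simp only [feedbackProd, Fin.prod_univ_one, feedbackSuffix]
  have h : ∀ past : Fin 0 → Y, Fin.append u past = u := fun past => by
    funext s
    exact Fin.append_left u past s
  exact congrArg (fun p => g (x (Fin.last n) p) y) (h _)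

lemma sum_feedbackProd_eq_one {g : X → Y → ℝ} (hg : ∀ x, ∑ y, g x y = 1)
    (x : FeedbackInput n X Y) : ∑ y, feedbackProd g x y = 1 := by
  induction n with
  | zero => simp [feedbackProd]
  | succ n ih => simp_rw [sum_feedbackProd_succ, hg, mul_one, ih]

lemma pow_le_sum_feedbackProd {g : X → Y → ℝ} (hg0 : ∀ x y, 0 ≤ g x y) {z : ℝ} (hz : 0 ≤ z)
    (hg : ∀ x, z ≤ ∑ y, g x y) (x : FeedbackInput n X Y) :
    z ^ n ≤ ∑ y, feedbackProd g x y := by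
  induction n with
  | zero => simp [feedbackProd]
  | succ n ih =>
    rw [sum_feedbackProd_succ, pow_succ]
    refine (mul_le_mul_of_nonneg_right (ih (feedbackPrefix x)) hz).trans ?_
    rw [Finset.sum_mul]
    exact Finset.sum_le_sum fun u _ => mul_le_mul_of_nonneg_left (hg _)
      (Finset.prod_nonneg fun t _ => hg0 _ _)

lemma feedbackChannel_mem_stdSimplex (W : X → stdSimplex ℝ Y) (x : FeedbackInput n X Y) :
    feedbackChannel (fun _ => W) x ∈ stdSimplex ℝ (Fin n → Y) :=
  ⟨fun _ => Finset.prod_nonneg fun _ _ => stdSimplex.zero_le _ _,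
    sum_feedbackProd_eq_one (g := fun x y => W x y) (fun x => stdSimplex.sum_eq_one (W x)) x⟩

lemma prod_mem_stdSimplex {q : Y → ℝ} (hq : q ∈ stdSimplex ℝ Y) :
    (fun y : Fin n → Y => ∏ t, q (y t)) ∈ stdSimplex ℝ (Fin n → Y) :=
  ⟨fun _ => Finset.prod_nonneg fun _ _ => hq.1 _,
    sum_feedbackProd_eq_one (g := fun (_ : Unit) y => q y) (fun _ => hq.2) fun _ _ => ()⟩

/-- A bound on the divergence of all rows of the channel from `q` holds, multiplied by the block
length, for the channel with feedback and the product law of `q`. -/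
lemma exp_neg_le_affinity_feedbackChannel {W : X → stdSimplex ℝ Y} {α c : ℝ} {q : Y → ℝ}
    (hq : q ∈ stdSimplex ℝ Y) (h : ∀ x, Real.exp (-c) ≤ affinity α (W x) q)
    (x : FeedbackInput n X Y) : Real.exp (-(c * n)) ≤
      affinity α (feedbackChannel (fun _ => W) x) (fun y => ∏ t, q (y t)) := by
  have h1 := pow_le_sum_feedbackProd (g := fun x y => W x y ^ α * q y ^ (1 - α))
    (fun x y => mul_nonneg (Real.rpow_nonneg (stdSimplex.zero_le _ _) _)
      (Real.rpow_nonneg (hq.1 y) _)) (Real.exp_pos _).le h x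
  have h2 : Real.exp (-(c * n)) = Real.exp (-c) ^ n := by
    rw [← Real.exp_nat_mul]; congr 1; ring
  rw [h2]
  refine h1.trans (le_of_eq (Finset.sum_congr rfl fun y _ => ?_))
  rw [feedbackProd, feedbackChannel, Finset.prod_mul_distrib,
    Real.finsetProd_rpow _ _ fun t _ => stdSimplex.zero_le _ _,
    Real.finsetProd_rpow _ _ fun t _ => hq.1 _]

end Feedback

/-! ### The reference law on one block and on the whole string -/

section Reference

variable {X Y : Type*} [Fintype X] [Fintype Y] {W : X → stdSimplex ℝ Y}

/-- On a block of length `l` a single output law serves as the reference for all feedback inputs: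
the uniform mixture of the product laws of the Rényi centers over a net of orders in `[α₀, α₁]`.
The mixture costs `log (1 / ε)` in the first exponent. The mesh `ε` of the net costs
`ε * R / α₀ ^ 2` per letter in the second one, since an order `α` is used with the center of the
largest net point `η ≤ α`, and `(1 - α) / α * D_α ≤ (1 - η) / η * D_η`. The order `α₀` starts the
path because `C_{α₀} ≤ R`, and `α₁` ends it because `(1 - α₁) / α₁ * C_{α₁} ≤ E`. -/
lemma exists_block_reference [Nonempty X] {α₀ α₁ ε E R : ℝ} (hα₀ : 0 < α₀) (hα₀₁ : α₀ < α₁)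
    (hα₁ : α₁ < 1) (hε : 0 < ε) (hε₀ : ε ≤ α₀ / 2) (hε₁ : ε ≤ (1 - α₁) / 2)
    (hR : renyiCapacity α₀ W ≤ R) (hα₁E : (1 - α₁) / α₁ * renyiCapacity α₁ W ≤ E)
    (hE : ∀ η ∈ Set.Ioo (0 : ℝ) 1, (1 - η) / η * (renyiCapacity η W - R) ≤ E) (l : ℕ) :
    ∃ Q ∈ stdSimplex ℝ (Fin l → Y), ∀ x : FeedbackInput l X Y,
      HasAuxiliaryLaw (feedbackChannel (fun _ => W) x) Q (R * l + Real.log (1 / ε))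
        ((E + ε * R / α₀ ^ 2) * l)
        (((1 + 3 / 2 * renyiCapacity (1 / 2) W * l) / (1 - α₁)) ^ 2)
        (((1 + 3 / 2 * renyiCapacity (1 / 2) W * l) / α₀) ^ 2) := by
  set C := renyiCapacity (1 / 2) W with hCdef
  have hl : (0 : ℝ) ≤ l := Nat.cast_nonneg l
  have hR0 : 0 ≤ R := (renyiCapacity_nonneg (W := W) ⟨hα₀, hα₀₁.trans hα₁⟩).trans hR
  have hC0 : 0 ≤ C := renyiCapacity_nonneg ⟨by norm_num, by norm_num⟩
  choose! q hq hqc using fun (η : ℝ) (hη : η ∈ Set.Ioo (0 : ℝ) 1) => exists_renyi_center W hη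
  -- A net with at most `1 / ε` points, consecutive ones at distance at most `ε`.
  set N := ⌈(α₁ - α₀) / ε⌉₊ with hNdef
  have hNpos : 0 < N := Nat.ceil_pos.2 (div_pos (by linarith) hε)
  have hN0 : (0 : ℝ) < N := Nat.cast_pos.2 hNpos
  have hNlt : (N : ℝ) < (α₁ - α₀) / ε + 1 := Nat.ceil_lt_add_one (div_nonneg (by linarith) hε.le)
  have hNge : (α₁ - α₀) / ε ≤ N := Nat.le_ceil _
  have hN1 : (N : ℝ) + 1 ≤ 1 / ε := by
    rw [le_div_iff₀ hε]
    have h1 : (N : ℝ) * ε < ((α₁ - α₀) / ε + 1) * ε := mul_lt_mul_of_pos_right hNlt hε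
    have h2 : ((α₁ - α₀) / ε + 1) * ε = α₁ - α₀ + ε := by field_simp
    linarith
  set δ := (α₁ - α₀) / N with hδ
  have hδ0 : 0 ≤ δ := div_nonneg (by linarith) hN0.le
  have hδε : δ ≤ ε := by
    rw [hδ, div_le_iff₀ hN0]
    rw [div_le_iff₀ hε] at hNge
    linarith
  set η : ℕ → ℝ := fun i => α₀ + i * δ with hη
  have hη0 : η 0 = α₀ := by simp [hη]
  have hηN : η N = α₁ := by simp only [hη, hδ]; field_simp; ring
  have hηge : ∀ i, α₀ ≤ η i := fun i => by
    have : (0 : ℝ) ≤ i * δ := mul_nonneg (Nat.cast_nonneg i) hδ0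
    simp only [hη]; linarith
  have hηle : ∀ i ≤ N, η i ≤ α₁ := fun i hi => by
    rw [← hηN]
    have : (i : ℝ) * δ ≤ N * δ := mul_le_mul_of_nonneg_right (Nat.cast_le.2 hi) hδ0
    simp only [hη]; linarith
  have hηsucc : ∀ i, η (i + 1) = η i + δ := fun i => by simp only [hη]; push_cast; ring
  have hηmem : ∀ i ≤ N, η i ∈ Set.Ioo (0 : ℝ) 1 := fun i hi =>
    ⟨hα₀.trans_le (hηge i), (hηle i hi).trans_lt hα₁⟩
  set Q : ℕ → (Fin l → Y) → ℝ := fun i y => ∏ t, q (η i) (y t) with hQdef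
  have hQ : ∀ i ≤ N, Q i ∈ stdSimplex ℝ (Fin l → Y) := fun i hi =>
    prod_mem_stdSimplex (hq _ (hηmem i hi))
  have hinv : ((N : ℝ) + 1)⁻¹ * (N + 1) = 1 := inv_mul_cancel₀ (by positivity)
  refine ⟨fun y => ((N : ℝ) + 1)⁻¹ * ∑ i ∈ Finset.range (N + 1), Q i y,
    ⟨fun y => mul_nonneg (by positivity) (Finset.sum_nonneg fun i hi =>
      (hQ i (by simpa [Nat.lt_succ_iff] using hi)).1 y), ?_⟩, fun x => ?_⟩
  · rw [← Finset.mul_sum, Finset.sum_comm, Finset.sum_congr rfl fun i hi =>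
      (hQ i (by simpa [Nat.lt_succ_iff] using hi)).2]
    simpa using hinv
  have hP := feedbackChannel_mem_stdSimplex W x
  set P := feedbackChannel (fun _ => W) x with hPdef
  set e := (E + ε * R / α₀ ^ 2) * l with he
  set B := 3 / 2 * C * l with hB
  have hslack : 0 ≤ ε * R / α₀ ^ 2 := by positivity
  have hbase : ∀ i ≤ N, Real.exp (-((1 - η i) * renyiCapacity (η i) W * l)) ≤
      affinity (η i) P (Q i) := fun i hi =>
    exp_neg_le_affinity_feedbackChannel (hq _ (hηmem i hi)) (hqc _ (hηmem i hi)) x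
  have horder : ∀ i < N, ∀ α ∈ Set.Icc (η i) (η (i + 1)),
      Real.exp (-(α / η i * ((1 - η i) * renyiCapacity (η i) W * l))) ≤ affinity α P (Q i) :=
    fun i hi α hα => exp_neg_le_affinity_of_le (hηmem i hi.le).1 hα.1
      (hα.2.trans_lt (hηmem (i + 1) hi).2) hP.1 (hQ i hi.le) (hbase i hi.le)
  have hcap : ∀ i ≤ N, (1 - η i) * renyiCapacity (η i) W ≤ C ∧
      (1 - η i) * renyiCapacity (η i) W ≤ η i * E + (1 - η i) * R := fun i hi => by
    refine ⟨one_sub_mul_renyiCapacity_le (hηmem i hi), ?_⟩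
    have h1 := hE _ (hηmem i hi)
    rw [div_mul_eq_mul_div, div_le_iff₀ (hηmem i hi).1] at h1
    linarith
  have hex : ∃ α Q', α ∈ Set.Icc (η 0) (η N) ∧ Q' ∈ stdSimplex ℝ (Fin l → Y) ∧
      (∀ y, Q' y ≤ ∑ i ∈ Finset.range (N + 1), Q i y) ∧ Real.exp (-B) ≤ affinity α P Q' ∧
      relEntropy (tilt α P Q') Q' ≤ R * l ∧ relEntropy (tilt α P Q') P ≤ e := by
    refine exists_tilt_of_net hP hηmem (fun i _ => by rw [hηsucc]; linarith) hQ
      (fun i hi => ?_) (fun i hi => ?_) (fun i hi α hα => ?_) (fun i hi α hα => ?_) ?_ ?_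
    · refine le_trans (Real.exp_le_exp.2 (neg_le_neg ?_)) (hbase i hi)
      have := mul_le_mul_of_nonneg_right (hcap i hi).1 hl
      have : 0 ≤ C * l := by positivity
      linarith
    · refine le_trans (Real.exp_le_exp.2 (neg_le_neg ?_)) (hbase i hi)
      have h1 := mul_le_mul_of_nonneg_right (hcap i hi).2 hl
      have h2 : 0 ≤ η i * (ε * R / α₀ ^ 2) * l :=
        mul_nonneg (mul_nonneg (hηmem i hi).1.le hslack) hl
      simp only [he]
      linarith
    · refine le_trans (Real.exp_le_exp.2 (neg_le_neg ?_)) (horder i hi α hα)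
      have hηi := (hηmem i hi.le).1
      have h1 : α / η i ≤ 3 / 2 := by
        rw [div_le_iff₀ hηi]
        have := hα.2
        rw [hηsucc] at this
        linarith [hηge i]
      have h2 := mul_le_mul_of_nonneg_right (hcap i hi.le).1 hl
      calc _ ≤ α / η i * (C * l) :=
            mul_le_mul_of_nonneg_left h2 (div_nonneg (hηi.le.trans hα.1) hηi.le)
        _ ≤ 3 / 2 * (C * l) := mul_le_mul_of_nonneg_right h1 (by positivity)
        _ = B := by rw [hB]; ring
    · refine le_trans (Real.exp_le_exp.2 (neg_le_neg ?_)) (horder i hi α hα)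
      have hηi := (hηmem i hi.le).1
      have hαpos : 0 < α := hηi.trans_le hα.1
      have hαη : α - η i ≤ ε := by
        have := hα.2
        rw [hηsucc] at this
        linarith
      have h1 := mul_le_mul_of_nonneg_right (hcap i hi.le).2 hl
      have h2 : (α - η i) / η i ≤ α * (ε / α₀ ^ 2) := by
        rw [div_le_iff₀ hηi]
        have h3 : α₀ ^ 2 ≤ α * η i := by
          rw [sq]
          exact mul_le_mul ((hηge i).trans hα.1) (hηge i) hα₀.le hαpos.le
        calc α - η i ≤ ε / α₀ ^ 2 * α₀ ^ 2 := by rw [div_mul_cancel₀ _ (by positivity)]; exact hαη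
          _ ≤ ε / α₀ ^ 2 * (α * η i) := mul_le_mul_of_nonneg_left h3 (by positivity)
          _ = _ := by ring
      calc _ ≤ α / η i * ((η i * E + (1 - η i) * R) * l) :=
            mul_le_mul_of_nonneg_left h1 (by positivity)
        _ = (α * E + (1 - α) * R + (α - η i) / η i * R) * l := by field_simp; ring
        _ ≤ (α * E + (1 - α) * R + α * (ε / α₀ ^ 2) * R) * l := by gcongr
        _ = α * e + (1 - α) * (R * l) := by rw [he]; ring
    · refine le_trans (Real.exp_le_exp.2 (neg_le_neg ?_)) (hbase 0 (Nat.zero_le _))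
      rw [hη0, mul_assoc]
      refine mul_le_mul_of_nonneg_left (mul_le_mul_of_nonneg_right hR hl) (by linarith)
    · refine le_trans (Real.exp_le_exp.2 (neg_le_neg ?_)) (hbase N le_rfl)
      rw [hηN]
      have hα₁0 := hα₀.trans hα₀₁
      rw [div_mul_eq_mul_div, div_le_iff₀ hα₁0] at hα₁E
      have h1 := mul_le_mul_of_nonneg_right hα₁E hl
      have h2 : 0 ≤ α₁ * (ε * R / α₀ ^ 2) * l := mul_nonneg (mul_nonneg hα₁0.le hslack) hl
      simp only [he]
      linarith
  obtain ⟨α, Q', hα, hQ', hQ'le, hZ, hr', he'⟩ := hex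
  rw [hη0, hηN] at hα
  have hα01 : α ∈ Set.Ioo (0 : ℝ) 1 := ⟨hα₀.trans_le hα.1, hα.2.trans_lt hα₁⟩
  have hZ0 := (Real.exp_pos _).trans_le hZ
  have hlog := (Real.le_log_iff_exp_le hZ0).2 hZ
  have hlog' := Real.log_nonpos hZ0.le (affinity_le_one hα01 hP hQ')
  refine (hasAuxiliaryLaw_tilt hα01 hP hQ' hZ0 hr' he').mono hP.1 (fun y => ?_) le_rfl ?_ ?_
  · rw [Real.exp_add, Real.exp_log (by positivity), mul_assoc]
    refine mul_le_mul_of_nonneg_left ?_ (Real.exp_pos _).le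
    have hS := (hQ'.1 y).trans (hQ'le y)
    refine (hQ'le y).trans ?_
    rw [← mul_assoc]
    refine le_mul_of_one_le_left hS ?_
    calc (1 : ℝ) = (N + 1) * ((N : ℝ) + 1)⁻¹ := by rw [mul_comm, hinv]
      _ ≤ _ := mul_le_mul_of_nonneg_right hN1 (by positivity)
  · refine pow_le_pow_left₀ (div_nonneg (by linarith) (by linarith [hα01.2])) ?_ 2
    exact div_le_div₀ (by positivity) (by linarith) (by linarith) (by linarith [hα.2])
  · refine pow_le_pow_left₀ (div_nonneg (by linarith) hα01.1.le) ?_ 2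
    exact div_le_div₀ (by positivity) (by linarith) hα₀ hα.1

/-- The reference laws of at most `k` blocks of length at most `L` multiply to one for the whole
string. The auxiliary law of a block may depend on the outputs of the earlier blocks. -/
lemma exists_reference_of_blocks {X Y : Type*} [Fintype Y] {W : X → stdSimplex ℝ Y} {L : ℕ} {r g e s t : ℝ}
    (hblock : ∀ l ≤ L, ∃ Q ∈ stdSimplex ℝ (Fin l → Y), ∀ x : FeedbackInput l X Y,
      HasAuxiliaryLaw (feedbackChannel (fun _ => W) x) Q (r * l + g) (e * l) s t)
    (k n : ℕ) (hn : n ≤ k * L) :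
    ∃ Q ∈ stdSimplex ℝ (Fin n → Y), ∀ x : FeedbackInput n X Y,
      HasAuxiliaryLaw (feedbackChannel (fun _ => W) x) Q (r * n + k * g) (e * n) (k * s)
        (k * t) := by
  induction k generalizing n with
  | zero =>
    obtain rfl : n = 0 := by simpa using hn
    refine ⟨fun _ => 1, ⟨fun _ => zero_le_one, by simp⟩, fun x => ?_⟩
    refine ⟨fun _ => 1, fun _ => 0, fun _ => 0, ⟨fun _ => zero_le_one, by simp⟩, ?_⟩
    simp [feedbackChannel]
  | succ k ih =>
    obtain ⟨m, l, rfl, hm, hl⟩ : ∃ m l, n = m + l ∧ m ≤ k * L ∧ l ≤ L := by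
      refine ⟨n - min n L, min n L, by omega, ?_, by omega⟩
      rw [Nat.succ_mul] at hn
      omega
    obtain ⟨Q₁, hQ₁, h₁⟩ := ih m hm
    obtain ⟨Q₂, hQ₂, h₂⟩ := hblock l hl
    have hsymm : ∀ (u : Fin m → Y) (v : Fin l → Y),
        (Fin.appendEquiv m l).symm (Fin.append u v) = (u, v) := fun u v =>
      (Fin.appendEquiv m l).symm_apply_apply (u, v)
    refine ⟨fun y => Q₁ ((Fin.appendEquiv m l).symm y).1 * Q₂ ((Fin.appendEquiv m l).symm y).2,
      ⟨fun y => mul_nonneg (hQ₁.1 _) (hQ₂.1 _), ?_⟩, fun x => ?_⟩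
    · rw [sum_append]
      simp_rw [hsymm, ← Finset.mul_sum, hQ₂.2, mul_one, hQ₁.2]
    · have h := HasAuxiliaryLaw.concat (Fin.appendEquiv m l)
        (P := feedbackChannel (fun _ => W) x)
        (Q := fun y => Q₁ ((Fin.appendEquiv m l).symm y).1 * Q₂ ((Fin.appendEquiv m l).symm y).2)
        (P₂ := fun u => feedbackChannel (fun _ => W) (feedbackSuffix x u))
        (feedbackChannel_mem_stdSimplex W (feedbackPrefix x)).1 hQ₁.1
        (fun u v => feedbackProd_append (fun x y => W x y) x u v)
        (fun u v => by simp only [Equiv.symm_apply_apply])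
        (h₁ (feedbackPrefix x)) fun u => h₂ (feedbackSuffix x u)
      convert h using 1 <;> push_cast <;> ring

end Reference

/-! ### Averaging over the messages -/

section Averaging

variable {X Y : Type*} [Fintype Y] {n : ℕ} {R : ℝ}

lemma FeedbackCode.condErrorProb_eq_sum (c : FeedbackCode n R X Y)
    (W : X → stdSimplex ℝ Y) (m : Fin (messageCount n R)) :
    c.condErrorProb (fun _ => W) m =
      ∑ y with ¬ c.dec y = m, feedbackChannel (fun _ => W) (c.enc m) y := by
  rw [FeedbackCode.condErrorProb, ← (feedbackChannel_mem_stdSimplex W (c.enc m)).2,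
    ← Finset.sum_filter_add_sum_filter_not Finset.univ (fun y => c.dec y = m),
    Finset.sum_filter (fun y => c.dec y = m), add_sub_cancel_left]

/-- If one output law `Q` is a reference for all inputs, then decoding succeeds for the average
message with `Q`-probability `1 / M`, whatever the decoder, and the change of measure turns this
into a lower bound on the average error probability. -/
lemma FeedbackCode.le_avgErrorProb (c : FeedbackCode n R X Y) {W : X → stdSimplex ℝ Y}
    {Q : (Fin n → Y) → ℝ} (hQ : Q ∈ stdSimplex ℝ (Fin n → Y)) {r e s t d d' : ℝ}
    (h : ∀ x : FeedbackInput n X Y,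
      HasAuxiliaryLaw (feedbackChannel (fun _ => W) x) Q r e s t)
    (hd : 0 < d) (hd' : 0 < d') (hs : 4 * s ≤ d ^ 2) (ht : 4 * t ≤ d' ^ 2)
    (hr : d + r + Real.log 4 ≤ n * R) :
    Real.exp (-(d' + e + Real.log 4)) ≤ c.avgErrorProb (fun _ => W) := by
  have hM : Real.exp (n * R) ≤ messageCount n R := Nat.le_ceil _
  have hM0 : (0 : ℝ) < messageCount n R := (Real.exp_pos _).trans_le hM
  have hm : ∀ m, Real.exp (-(d' + e)) *
      (1 / 2 - Real.exp (d + r) * ∑ y with c.dec y = m, Q y) ≤ c.condErrorProb (fun _ => W) m :=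
    fun m => by
      rw [c.condErrorProb_eq_sum]
      exact (h (c.enc m)).exp_mul_le (feedbackChannel_mem_stdSimplex W _).1 hQ.1 hd hd' hs ht _
  have hsum := Finset.sum_le_sum fun m (_ : m ∈ Finset.univ) => hm m
  have hfib : ∑ m, ∑ y with c.dec y = m, Q y = 1 := by
    rw [Finset.sum_fiberwise, hQ.2]
  rw [← Finset.mul_sum, Finset.sum_sub_distrib, ← Finset.mul_sum, hfib] at hsum
  simp only [Finset.sum_const, Finset.card_univ, Fintype.card_fin, nsmul_eq_mul, mul_one] at hsum
  have h4 : 4 * Real.exp (d + r) ≤ messageCount n R := by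
    refine le_trans (le_of_eq ?_) ((Real.exp_le_exp.2 hr).trans hM)
    rw [Real.exp_add _ (Real.log 4), Real.exp_log (by norm_num)]; ring
  rw [FeedbackCode.avgErrorProb, one_div_mul_eq_div, le_div_iff₀ hM0]
  refine le_trans ?_ hsum
  rw [neg_add, Real.exp_add, Real.exp_neg (Real.log 4), Real.exp_log (by norm_num), mul_assoc]
  exact mul_le_mul_of_nonneg_left (by linarith) (Real.exp_pos _).le

end Averaging

/-! ### The sphere packing exponent and the bound -/

section Exponent

variable {X Y : Type*} [Fintype X] [Fintype Y] {W : X → stdSimplex ℝ Y}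

lemma spherePackingExponent_anti {R R' : ℝ} (h : R ≤ R') :
    spherePackingExponent R' W ≤ spherePackingExponent R W := by
  refine iSup_mono fun α => EReal.coe_le_coe_iff.2 ?_
  have hα := α.2
  exact mul_le_mul_of_nonneg_left (by linarith)
    (div_nonneg (by linarith [hα.2]) hα.1.le)

/-- At a rate that is at least some capacity of positive order, the sphere packing exponent is
finite: the orders below contribute nonpositive terms, and `(1 - α) / α * C_α` is bounded for the
orders above. -/
lemma exists_spherePackingExponent_eq_coe [Nonempty X] {α₀ R : ℝ} (hα₀ : α₀ ∈ Set.Ioo (0 : ℝ) 1)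
    (hR : renyiCapacity α₀ W ≤ R) : ∃ E : ℝ, spherePackingExponent R W = (E : EReal) ∧
      ∀ η ∈ Set.Ioo (0 : ℝ) 1, (1 - η) / η * (renyiCapacity η W - R) ≤ E := by
  have hC0 := renyiCapacity_nonneg (W := W) hα₀
  have hterm : ∀ η ∈ Set.Ioo (0 : ℝ) 1, (((1 - η) / η * (renyiCapacity η W - R) : ℝ) : EReal) ≤
      spherePackingExponent R W := fun η hη =>
    le_iSup (fun α : Set.Ioo (0 : ℝ) 1 =>
      (((1 - (α : ℝ)) / (α : ℝ) * (renyiCapacity (α : ℝ) W - R) : ℝ) : EReal)) ⟨η, hη⟩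
  have hup : spherePackingExponent R W ≤ (((1 - α₀) / α₀ * renyiCapacity α₀ W : ℝ) : EReal) := by
    refine iSup_le fun α => EReal.coe_le_coe_iff.2 ?_
    obtain ⟨α, hα⟩ := α
    have hq : 0 ≤ (1 - α) / α := div_nonneg (by linarith [hα.2]) hα.1.le
    have hq₀ : 0 ≤ (1 - α₀) / α₀ := div_nonneg (by linarith [hα₀.2]) hα₀.1.le
    rcases le_total α α₀ with h | h
    · have h1 := renyiCapacity_mono (W := W) hα.1 h hα₀.2
      have h2 := mul_nonneg hq₀ hC0
      have h3 := mul_nonneg hq (by linarith : 0 ≤ R - renyiCapacity α W)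
      simp only
      linarith
    · have h1 := renyiCapacity_scaled_anti (W := W) hα₀.1 h hα.2
      have h2 := mul_nonneg hq (hC0.trans hR)
      simp only
      linarith
  have hbot : spherePackingExponent R W ≠ ⊥ :=
    ne_bot_of_le_ne_bot (EReal.coe_ne_bot _) (hterm α₀ hα₀)
  have htop : spherePackingExponent R W ≠ ⊤ := ne_top_of_le_ne_top (EReal.coe_ne_top _) hup
  have hE := EReal.coe_toReal htop hbot
  refine ⟨_, hE.symm, fun η hη => ?_⟩
  have := hterm η hη
  rwa [← hE, EReal.coe_le_coe_iff] at this

end Exponent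

/-- Twice the standard deviation of the sum of `κ` block errors is at most the term of order
`n / √κ` in the error bounds. -/
lemma two_mul_sqrt_mul_le {C γ : ℝ} {n κ L : ℕ} (hC : 0 ≤ C) (hγ : 0 < γ) (hκ : 0 < κ)
    (hκn : κ ≤ n) (hL : L = n / κ + 1) :
    2 * √κ * ((1 + 3 / 2 * C * L) / γ) ≤ n * (8 * ((2 + C) / (γ * √κ))) := by
  have hκ0 : (0 : ℝ) < κ := Nat.cast_pos.2 hκ
  have hκn' : (κ : ℝ) ≤ n := Nat.cast_le.2 hκn
  have hs : 0 < √(κ : ℝ) := Real.sqrt_pos.2 hκ0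
  have hLκ : κ * (L : ℝ) ≤ 2 * n := by
    have h1 : κ * L ≤ 2 * n := by
      rw [hL, mul_add]
      have := Nat.mul_div_le n κ
      omega
    exact_mod_cast h1
  have h2 : 2 * (κ + 3 / 2 * C * (κ * L)) ≤ n * (8 * (2 + C)) := by
    have := mul_le_mul_of_nonneg_left hLκ hC
    linarith [mul_nonneg hC (hκ0.le.trans hκn')]
  calc _ = 2 * (κ + 3 / 2 * C * (κ * L)) / (γ * √κ) := by
        rw [eq_div_iff (by positivity)]
        field_simp
        rw [Real.sq_sqrt hκ0.le]
    _ ≤ n * (8 * (2 + C)) / (γ * √κ) := div_le_div_of_nonneg_right h2 (by positivity)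
    _ = _ := by ring

theorem lemma9 {X Y : Type*} [Fintype X] [Fintype Y] (W : X → stdSimplex ℝ Y)
    (hW : renyiCapacityZero W ≠ renyiCapacity 1 W)
    (R₀ R₁ : ℝ) (hR₀ : renyiCapacityZero W < R₀) (hR₀₁ : R₀ < R₁)
    (hR₁ : R₁ < renyiCapacity 1 W)
    (α₀ α₁ : ℝ) (hα₀ : α₀ ∈ Set.Ioo (0 : ℝ) 1) (hα₁ : α₁ ∈ Set.Ioo α₀ 1)
    (hCα₀ : renyiCapacity α₀ W = R₀)
    (hCα₁ : (((1 - α₁) / α₁ * renyiCapacity α₁ W : ℝ) : EReal) = spherePackingExponent R₁ W)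
    (ε : ℝ) (hε : 0 < ε) (hε' : ε ≤ min α₀ (1 - α₁) / 2)
    (n κ : ℕ) (hn : 0 < n) (hκ : 0 < κ) (hκn : κ ≤ n)
    (R δ₁ δ₂ : ℝ)
    (hδ₁ : δ₁ = Real.log 4 / n
      + 8 * ((2 + renyiCapacity (1 / 2) W) / ((1 - α₁) * Real.sqrt κ))
      + (κ : ℝ) / n * Real.log ((n : ℝ) + 1 / ε))
    (hδ₂ : δ₂ = Real.log 4 / n
      + 8 * ((2 + renyiCapacity (1 / 2) W) / (α₀ * Real.sqrt κ))
      + (κ : ℝ) * Real.log n / n + 2 * R * ε / α₀ ^ 2)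
    (hR_le : R ≤ R₁) (hR_ge : R₀ + δ₁ ≤ R)
    (c : FeedbackCode n R X Y) :
    ∃ E : ℝ, spherePackingExponent (R - δ₁) W = (E : EReal) ∧
      Real.exp (-(n * (E + δ₂))) ≤ c.avgErrorProb (fun _ => W) := by
  have hX : Nonempty X := by
    by_contra hX
    rw [not_nonempty_iff] at hX
    have h0 : ∀ α, renyiCapacity α W = 0 := fun α => by
      have : IsEmpty (stdSimplex ℝ X) := by
        rw [stdSimplex_of_isEmpty_index]; infer_instance
      exact Real.iSup_of_isEmpty _
    rw [h0] at hR₁ hCα₀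
    linarith
  have hα₁0 : 0 < α₁ := hα₀.1.trans hα₁.1
  have hα₁1 : 0 < 1 - α₁ := by linarith [hα₁.2]
  have hε₀ : ε ≤ α₀ / 2 := by linarith [min_le_left α₀ (1 - α₁)]
  have hε₁ : ε ≤ (1 - α₁) / 2 := by linarith [min_le_right α₀ (1 - α₁)]
  have hn0 : (0 : ℝ) < n := Nat.cast_pos.2 hn
  have hn1 : (1 : ℝ) ≤ n := Nat.one_le_cast.2 hn
  have hκ0 : (0 : ℝ) < κ := Nat.cast_pos.2 hκ
  have hsκ : 0 < √(κ : ℝ) := Real.sqrt_pos.2 hκ0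
  have hC : 0 ≤ renyiCapacity (1 / 2) W := renyiCapacity_nonneg ⟨by norm_num, by norm_num⟩
  have hR₀0 : 0 ≤ R₀ := hCα₀ ▸ renyiCapacity_nonneg hα₀
  have hinv : 0 < 1 / ε := by positivity
  have hlog4 : 0 ≤ Real.log 4 := Real.log_nonneg (by norm_num)
  have hlogn : 0 ≤ Real.log n := Real.log_nonneg hn1
  have hlog : 0 ≤ Real.log ((n : ℝ) + 1 / ε) := Real.log_nonneg (by linarith)
  have hδ₁0 : 0 ≤ δ₁ := by rw [hδ₁]; positivity
  obtain ⟨E, hEeq, hE⟩ := exists_spherePackingExponent_eq_coe (W := W) (R := R - δ₁) hα₀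
    (by linarith)
  refine ⟨E, hEeq, ?_⟩
  have hα₁E : (1 - α₁) / α₁ * renyiCapacity α₁ W ≤ E := by
    have := spherePackingExponent_anti (W := W) (by linarith : R - δ₁ ≤ R₁)
    rwa [← hCα₁, hEeq, EReal.coe_le_coe_iff] at this
  set C := renyiCapacity (1 / 2) W
  obtain ⟨L, hL⟩ : ∃ L, L = n / κ + 1 := ⟨_, rfl⟩
  -- The moments of a block are increasing in its length, which is at most `L`.
  have hblock : ∀ l ≤ L, ∃ Q ∈ stdSimplex ℝ (Fin l → Y), ∀ x : FeedbackInput l X Y,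
      HasAuxiliaryLaw (feedbackChannel (fun _ => W) x) Q ((R - δ₁) * l + Real.log (1 / ε))
        ((E + ε * (R - δ₁) / α₀ ^ 2) * l) (((1 + 3 / 2 * C * L) / (1 - α₁)) ^ 2)
        (((1 + 3 / 2 * C * L) / α₀) ^ 2) := by
    intro l hl
    obtain ⟨Q, hQ, h⟩ := exists_block_reference (W := W) hα₀.1 hα₁.1 hα₁.2 hε hε₀ hε₁
      (by linarith : renyiCapacity α₀ W ≤ R - δ₁) hα₁E hE l
    have hl' : (l : ℝ) ≤ L := Nat.cast_le.2 hl
    have hα₀0 := hα₀.1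
    refine ⟨Q, hQ, fun x => (h x).mono (feedbackChannel_mem_stdSimplex W x).1
      (fun _ => le_rfl) le_rfl ?_ ?_⟩ <;> gcongr
  obtain ⟨Q, hQ, h⟩ := exists_reference_of_blocks hblock κ n (by
    rw [hL, mul_add, mul_one]
    have := Nat.div_add_mod n κ
    have := Nat.mod_lt n hκ
    omega)
  have hα₀0 := hα₀.1
  have hsq : ∀ σ : ℝ, 4 * (κ * σ ^ 2) ≤ (2 * √κ * σ) ^ 2 := fun σ => by
    rw [mul_pow, mul_pow, Real.sq_sqrt hκ0.le]
    linarith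
  have hd := two_mul_sqrt_mul_le hC hα₁1 hκ hκn hL
  have hd' := two_mul_sqrt_mul_le hC hα₀.1 hκ hκn hL
  -- `d` and `d'` are two standard deviations, so each of the two deviations has probability at most
  -- one quarter.
  refine le_trans (Real.exp_le_exp.2 (neg_le_neg ?_)) (c.le_avgErrorProb hQ h
    (d := 2 * √κ * ((1 + 3 / 2 * C * L) / (1 - α₁))) (d' := 2 * √κ * ((1 + 3 / 2 * C * L) / α₀))
    (by positivity) (by positivity) (hsq _) (hsq _) ?_)
  · have h1 : n * δ₂ = Real.log 4 + n * (8 * ((2 + C) / (α₀ * √κ))) + κ * Real.log n +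
        2 * (ε * R / α₀ ^ 2) * n := by
      rw [hδ₂]; field_simp
    have h2 : ε * (R - δ₁) / α₀ ^ 2 * n ≤ ε * R / α₀ ^ 2 * n := by gcongr; linarith
    have h3 : 0 ≤ ε * R / α₀ ^ 2 * n := by
      have : 0 ≤ R := by linarith
      positivity
    have h4 : 0 ≤ κ * Real.log n := by positivity
    linarith
  · have h1 : n * δ₁ = Real.log 4 + n * (8 * ((2 + C) / ((1 - α₁) * √κ))) +
        κ * Real.log (n + 1 / ε) := by
      rw [hδ₁]; field_simp
    have h2 : κ * Real.log (1 / ε) ≤ κ * Real.log (n + 1 / ε) :=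
      mul_le_mul_of_nonneg_left (Real.log_le_log hinv (by linarith)) hκ0.le
    linarith
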